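/- Let $4\le n\le 8$. Let $A$ be the Cartan matrix on the nodes $0,1,\dots,n$ in which the nodes $0,1,\dots,n-1$ form a chain, node $n$ is joined to node $n-3$, $A_{IJ}=-1$ for joined nodes and $0$ for distinct unjoined ones, $A_{00}=0$ and $A_{ii}=2$ for $i\ge1$. The Borcherds superalgebra $U_{n+1}$ is the real Lie superalgebra generated by $e_I,f_I,h_I$ ($0\le I\le n$), with $e_0,f_0$ odd and all other generators even, subject to the Chevalley relations $[h_I,e_J]=A_{IJ}e_J$, $[h_I,f_J]=-A_{IJ}f_J$, $[\![e_I,f_J]\!]=\delta_{IJ}h_J$, $[h_I,h_J]=0$ and the Serre relations $(\mathrm{ad}\,e_i)^{1-A_{iJ}}e_J=(\mathrm{ad}\,f_i)^{1-A_{iJ}}f_J=0$ ($1\le i\le n$, $J\ne i$), $\{e_0,e_0\}=\{f_0,f_0\}=0$. It is $\mathbb Z$-graded with $e_0$ at level $-1$, $f_0$ at level $1$ and the other generators at level $0$; write $(U_{n+1})_p$ for level $p$. Level parity is the parity of the superalgebra. The elements $e_i,f_i,h_i$ with $i\ge1$ generate the subalgebra $\mathfrak g=E_n$. Let $\langle\cdot|\cdot\rangle$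 be the invariant supersymmetric bilinear form ($\langle[\![x,y]\!]|z\rangle=\langle x|[\![y,z]\!]\rangle$, and $\langle x|y\rangle=(-1)^{pq}\langle y|x\rangle$ for $x,y$ of levels $p,q$, which is $0$ unless $p+q=0$) with $\langle h_I|h_J\rangle=A_{IJ}$, $\langle e_I|f_J\rangle=\delta_{IJ}$, $\langle e_I|e_J\rangle=\langle f_I|f_J\rangle=0$. Let $(E_{M})$ and $(F^{M})$ be bases of $(U_{n+1})_{-1}$ and $(U_{n+1})_{1}$ with $\langle E_M|F^N\rangle=\delta_M{}^N$, and put $E_{M_1\cdots M_k}=[\![E_{M_1},[\![E_{M_2},\dots,[\![E_{M_{k-1}},E_{M_k}]\!]\cdots]\!]]\!]$ and likewise $F^{M_1\cdots M_k}$. Let $\mathbf s_k$ be the representation of $E_n$ on $(U_{n+1})_{-k}$, realised in $(\mathbf s_1)^{\otimes k}$ through the elements $E_{M_1\cdots M_k}$, and let $(\mathbb P_k)_{M_1\cdots M_k}{}^{N_1\cdots N_k}$ be the projector on $\mathbf s_k$: the idempotent for which $c^{M_1\cdots M_k}(\mathbb P_k)_{M_1\cdots M_k}{}^{N_1\cdots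 N_k}=0$ if and only if $c^{M_1\cdots M_k}E_{M_1\cdots M_k}=0$, and $(\mathbb P_k)_{M_1\cdots M_k}{}^{N_1\cdots N_k}d_{N_1\cdots N_k}=0$ if and only if $d_{N_1\cdots N_k}F^{N_1\cdots N_k}=0$. Upper angle brackets $T^{\langle N_1\cdots N_k\rangle}=T^{M_1\cdots M_k}(\mathbb P_k)_{M_1\cdots M_k}{}^{N_1\cdots N_k}$ denote projection on $\mathbf s_k$. Let $p\ge2$, and assume that there are nonzero real numbers $a_k$ with $$\langle E_{M_1\cdots M_k}|F^{N_1\cdots N_k}\rangle=a_k(\mathbb P_k)_{M_1\cdots M_k}{}^{N_1\cdots N_k}\qquad(k=2,\dots,p),$$ and put $a_1=1$. For the values of $k$ needed below set $$\mathtt Y^{N_1\cdots N_k}{}_{M_1\cdots M_{k+1}}=\tfrac1{a_k}[F^{N_1\cdots N_k},E_{M_1\cdots M_{k+1}}],\qquad \mathtt X_{M|N_1\cdots N_k}{}^{P_1\cdots P_k}=\tfrac1{a_k}[E_M,[\![E_{N_1\cdots N_k},F^{P_1\cdots P_k}]\!]].$$ Then $$\mathtt X_{M|N_1\cdots N_p}{}^{P_1\cdots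 P_p}=\mathtt X_{M|N_1}{}^{\langle P_1}\delta_{N_2}{}^{P_2}\cdots\delta_{N_p}{}^{P_p\rangle}+\dots+\delta_{N_1}{}^{\langle P_1}\cdots\delta_{N_{p-1}}{}^{P_{p-1}}\mathtt X_{M|N_p}{}^{P_p\rangle},$$ $$\mathtt Y^{N_1\cdots N_p}{}_{M_1\cdots M_{p+1}}=-\delta_{M_1}{}^{\langle N_1}\mathtt Y^{N_2\cdots N_p\rangle}{}_{M_2\cdots M_{p+1}}-\mathtt X_{M_1|M_2\cdots M_{p+1}}{}^{N_1\cdots N_p},$$ $$\mathtt Y^{M}{}_{NP}=-\mathtt X_{N|P}{}^M-\mathtt X_{P|N}{}^M.$$ Moreover, let $\mathbf r_1=\mathbf s_1$, and let $R$ be a representation constraint, that is, any $E_n$-invariant subspace of the space $\bar{\mathbf r}_1\otimes\mathfrak g$ of embedding tensors $X=(X_M)$, $X_M=\Theta_M{}^\alpha t_\alpha\in\mathfrak g$; write $[X_M,E_N]=(X_M)_N{}^PE_P$. The tensor hierarchy of $R$ is given by the intertwiners $Y^P{}_{MN}=-(X_M)_N{}^P-(X_N)_M{}^P$ and, for $k\ge2$,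 $$Y^{M_1\cdots M_k}{}_{N_1\cdots N_{k+1}}=-\delta_{N_1}{}^{\langle M_1}Y^{M_2\cdots M_k\rangle}{}_{N_2\cdots N_{k+1}}-(X_{N_1})_{N_2\cdots N_{k+1}}{}^{\langle M_1\cdots M_k\rangle},$$ where $(X_N)_{N_1\cdots N_k}{}^{M_1\cdots M_k}$ is the action of $X_N$ on $(\mathbf r_1)^{\otimes k}$, the angle brackets now denote an $E_n$-equivariant projection on $\mathbf r_k$, and $\mathbf r_{k+1}$ is the representation determined by the lower indices of $Y^{M_1\cdots M_k}{}_{N_1\cdots N_{k+1}}$ when $X$ ranges over $R$: its conjugate is the span of these lower-index tensors in $(\bar{\mathbf r}_1)^{\otimes(k+1)}$, and the projection on $\mathbf r_{k+1}$ annihilates exactly the tensors $c^{N_1\cdots N_{k+1}}$ that all of them annihilate. Similarly the conjugate of $\mathbf s_k$ is the space of tensors $M_1\cdots M_k\mapsto\varphi(E_{M_1\cdots M_k})$, $\varphi$ a linear functional. If $\mathbf r_2=\mathbf s_2$, then $\mathbf r_k\subseteq\mathbf s_k$ for $k=1,2,\dots,p+1$ (equality and inclusion being those of the conjugate subspaces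 of $(\bar{\mathbf r}_1)^{\otimes k}$). -/

import Mathlib

open scoped Classical in
/-- The sign `(-1)^(p*q)` of two homogeneous elements of levels `p` and `q`. -/
noncomputable def koszulSign (p q : ℤ) : ℝ := if Odd p ∧ Odd q then -1 else 1

namespace Borcherds

/-! ### The Dynkin diagram -/

/-- Two nodes `i < j` are joined when they are consecutive in the chain `0, 1, …, n-1`,
or when `j = n` and `i = n-3`. -/
def joinedLT (n i j : ℕ) : Prop := (j = i + 1 ∧ j + 1 ≤ n) ∨ (j = n ∧ i + 3 = n)

instance (n i j : ℕ) : Decidable (joinedLT n i j) := by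
  unfold joinedLT; infer_instance

/-- The Cartan matrix of the diagram with nodes `0, 1, …, n`; node `0` is the black node,
the nodes `1, …, n` form the diagram of `E_n`. -/
def cartan (n : ℕ) : Matrix (Fin (n + 1)) (Fin (n + 1)) ℤ := fun i j =>
  if i = j then (if i = 0 then 0 else 2)
  else if joinedLT n i j ∨ joinedLT n j i then -1 else 0

/-! ### The superalgebra by generators and relations -/

/-- The Chevalley generators. -/
inductive Gen (n : ℕ) : Type
  | e (i : Fin (n + 1)) : Gen n
  | f (i : Fin (n + 1)) : Gen n
  | h (i : Fin (n + 1)) : Gen n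

/-- `e₀` has level `-1`, `f₀` has level `1`, all other generators have level `0`. -/
def Gen.level {n : ℕ} : Gen n → ℤ
  | .e i => if i = 0 then -1 else 0
  | .f i => if i = 0 then 1 else 0
  | .h _ => 0

/-- The level of a nonassociative word; words of odd level are the odd ones. -/
def wordLevel {n : ℕ} : FreeMagma (Gen n) → ℤ
  | .of g => g.level
  | .mul u v => wordLevel u + wordLevel v

/-- The free nonassociative real algebra on the Chevalley generators. -/
abbrev FreeAlg (n : ℕ) : Type := FreeNonUnitalNonAssocAlgebra ℝ (Gen n)

/-- A word as an element of the free nonassociative algebra. -/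
noncomputable def word {n : ℕ} (w : FreeMagma (Gen n)) : FreeAlg n :=
  MonoidAlgebra.single w 1

/-- A generator as an element of the free nonassociative algebra. -/
noncomputable def gen {n : ℕ} (g : Gen n) : FreeAlg n := word (.of g)

/-- The defining relations (the listed elements are set to zero): super-antisymmetry, the super
Jacobi identity, the Chevalley relations and the Serre relations. For the odd node, `A₀₀ = 0`
gives the Serre relations `{e₀, e₀} = {f₀, f₀} = 0`. -/
inductive IsRelator (n : ℕ) : FreeAlg n → Prop
  | skew (u v : FreeMagma (Gen n)) :
      IsRelator n (word u * word v +
        koszulSign (wordLevel u) (wordLevel v) • (word v * word u))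
  | jacobi (u v w : FreeMagma (Gen n)) :
      IsRelator n ((word u * word v) * word w - word u * (word v * word w) +
        koszulSign (wordLevel u) (wordLevel v) • (word v * (word u * word w)))
  | h_e (i j : Fin (n + 1)) :
      IsRelator n (gen (.h i) * gen (.e j) - (cartan n i j : ℝ) • gen (.e j))
  | h_f (i j : Fin (n + 1)) :
      IsRelator n (gen (.h i) * gen (.f j) + (cartan n i j : ℝ) • gen (.f j))
  | e_f (i j : Fin (n + 1)) :
      IsRelator n (gen (.e i) * gen (.f j) - if i = j then gen (.h j) else 0)
  | h_h (i j : Fin (n + 1)) :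
      IsRelator n (gen (.h i) * gen (.h j))
  | serre_e (i j : Fin (n + 1)) (hi : i ≠ 0) (hij : i ≠ j) :
      IsRelator n ((fun x => gen (.e i) * x)^[(1 - cartan n i j).toNat] (gen (.e j)))
  | serre_f (i j : Fin (n + 1)) (hi : i ≠ 0) (hij : i ≠ j) :
      IsRelator n ((fun x => gen (.f i) * x)^[(1 - cartan n i j).toNat] (gen (.f j)))
  | serre_e_zero : IsRelator n (gen (.e 0) * gen (.e 0))
  | serre_f_zero : IsRelator n (gen (.f 0) * gen (.f 0))

/-- The two-sided ideal generated by the relators. -/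
noncomputable def relIdeal (n : ℕ) : Submodule ℝ (FreeAlg n) :=
  sInf {I | (∀ x, IsRelator n x → x ∈ I) ∧ ∀ x ∈ I, ∀ y, x * y ∈ I ∧ y * x ∈ I}

theorem relIdeal_mul {n : ℕ} {x : FreeAlg n} (hx : x ∈ relIdeal n) (y : FreeAlg n) :
    x * y ∈ relIdeal n ∧ y * x ∈ relIdeal n := by
  simp only [relIdeal, Submodule.mem_sInf] at hx ⊢
  exact ⟨fun I hI => (hI.2 x (hx I hI) y).1, fun I hI => (hI.2 x (hx I hI) y).2⟩

/-- The Borcherds superalgebra `U_{n+1}`. -/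
def U (n : ℕ) : Type := FreeAlg n ⧸ relIdeal n

noncomputable instance (n : ℕ) : AddCommGroup (U n) :=
  inferInstanceAs (AddCommGroup (FreeAlg n ⧸ relIdeal n))

noncomputable instance (n : ℕ) : Module ℝ (U n) :=
  inferInstanceAs (Module ℝ (FreeAlg n ⧸ relIdeal n))

/-- The quotient map. -/
noncomputable def mk (n : ℕ) : FreeAlg n →ₗ[ℝ] U n := (relIdeal n).mkQ

/-- The superbracket as a bilinear map, induced by the multiplication of the free algebra. -/
noncomputable def bracketHom (n : ℕ) : U n →ₗ[ℝ] U n →ₗ[ℝ] U n :=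
  (relIdeal n).liftQ
    { toFun := fun x => (relIdeal n).mapQ (relIdeal n) (LinearMap.mul ℝ (FreeAlg n) x)
        (fun _ hy => (relIdeal_mul hy x).2)
      map_add' := by
        intro x y
        apply LinearMap.ext
        intro z
        obtain ⟨z, rfl⟩ := (relIdeal n).mkQ_surjective z
        simp only [Submodule.mkQ_apply, Submodule.mapQ_apply, map_add, LinearMap.add_apply,
          Submodule.Quotient.mk_add]
        rfl
      map_smul' := by
        intro c x
        apply LinearMap.ext
        intro z
        obtain ⟨z, rfl⟩ := (relIdeal n).mkQ_surjective z
        simp only [Submodule.mkQ_apply, Submodule.mapQ_apply, map_smul, LinearMap.smul_apply,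
          Submodule.Quotient.mk_smul]
        rfl }
    (by
      intro x hx
      rw [LinearMap.mem_ker]
      apply LinearMap.ext
      intro z
      obtain ⟨z, rfl⟩ := (relIdeal n).mkQ_surjective z
      exact (Submodule.Quotient.mk_eq_zero (relIdeal n)).2 (relIdeal_mul hx z).1)

/-- The superbracket of `U_{n+1}`. -/
noncomputable instance (n : ℕ) : Bracket (U n) (U n) := ⟨fun x y => bracketHom n x y⟩

theorem bracketHom_apply {n : ℕ} (x y : U n) : bracketHom n x y = ⁅x, y⁆ := rfl

theorem mk_mul {n : ℕ} (x y : FreeAlg n) : mk n (x * y) = ⁅mk n x, mk n y⁆ := rfl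

/-- The Chevalley generators `e_i` in `U_{n+1}`. -/
noncomputable def chevE {n : ℕ} (i : Fin (n + 1)) : U n := mk n (gen (.e i))
/-- The Chevalley generators `f_i` in `U_{n+1}`. -/
noncomputable def chevF {n : ℕ} (i : Fin (n + 1)) : U n := mk n (gen (.f i))
/-- The Cartan elements `h_i` in `U_{n+1}`. -/
noncomputable def chevH {n : ℕ} (i : Fin (n + 1)) : U n := mk n (gen (.h i))

/-- The subspace `(U_{n+1})_p` of level `p`. -/
noncomputable def level (n : ℕ) (p : ℤ) : Submodule ℝ (U n) :=
  Submodule.span ℝ {x | ∃ w : FreeMagma (Gen n), wordLevel w = p ∧ x = mk n (word w)}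

theorem mk_word_mem {n : ℕ} (w : FreeMagma (Gen n)) :
    mk n (word w) ∈ level n (wordLevel w) :=
  Submodule.subset_span ⟨w, rfl, rfl⟩

theorem bracket_mem_level {n : ℕ} {p q : ℤ} {x y : U n} (hx : x ∈ level n p)
    (hy : y ∈ level n q) : ⁅x, y⁆ ∈ level n (p + q) := by
  rw [← bracketHom_apply]
  induction hx using Submodule.span_induction with
  | zero => simp
  | add a b _ _ ha hb => rw [map_add, LinearMap.add_apply]; exact add_mem ha hb
  | smul c a _ ha => rw [map_smul, LinearMap.smul_apply]; exact Submodule.smul_mem _ c ha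
  | mem a ha =>
    obtain ⟨u, rfl, rfl⟩ := ha
    induction hy using Submodule.span_induction with
    | zero => simp
    | add a b _ _ ha hb => rw [map_add]; exact add_mem ha hb
    | smul c a _ ha => rw [map_smul]; exact Submodule.smul_mem _ c ha
    | mem b hb =>
      obtain ⟨v, rfl, rfl⟩ := hb
      rw [bracketHom_apply, ← mk_mul]
      have : word u * word v = word (FreeMagma.mul u v) := by
        simp only [word, MonoidAlgebra.single_mul_single, mul_one]; rfl
      rw [this]
      exact mk_word_mem (FreeMagma.mul u v)

/-- The subalgebra `E_n` of `U_{n+1}`, generated by `e_i, f_i, h_i` with `i = 1, …, n`. -/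
noncomputable def En (n : ℕ) : Submodule ℝ (U n) :=
  sInf {S | (∀ i : Fin (n + 1), i ≠ 0 → chevE i ∈ S ∧ chevF i ∈ S ∧ chevH i ∈ S) ∧
    ∀ x ∈ S, ∀ y ∈ S, ⁅x, y⁆ ∈ S}

theorem En_bracket_mem {n : ℕ} {x y : U n} (hx : x ∈ En n) (hy : y ∈ En n) :
    ⁅x, y⁆ ∈ En n := by
  simp only [En, Submodule.mem_sInf] at hx hy ⊢
  exact fun S hS => hS.2 x (hx S hS) y (hy S hS)

theorem En_le_level_zero (n : ℕ) : En n ≤ level n 0 := by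
  refine sInf_le ⟨fun i hi => ⟨?_, ?_, ?_⟩, fun x hx y hy => ?_⟩
  · have := mk_word_mem (.of (.e i) : FreeMagma (Gen n))
    simpa [wordLevel, Gen.level, chevE, gen, hi] using this
  · have := mk_word_mem (.of (.f i) : FreeMagma (Gen n))
    simpa [wordLevel, Gen.level, chevF, gen, hi] using this
  · have := mk_word_mem (.of (.h i) : FreeMagma (Gen n))
    simpa [wordLevel, Gen.level, chevH, gen] using this
  · simpa using bracket_mem_level hx hy

/-- The bracket of the Lie algebra `E_n`. -/
noncomputable instance (n : ℕ) : Bracket (En n) (En n) :=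
  ⟨fun x y => ⟨⁅(x : U n), (y : U n)⁆, En_bracket_mem x.2 y.2⟩⟩

/-! ### The bilinear form -/

/-- The invariant, supersymmetric bilinear form that extends the standard values on the Chevalley
generators. -/
structure IsInvariantForm (n : ℕ) (B : U n →ₗ[ℝ] U n →ₗ[ℝ] ℝ) : Prop where
  h_h : ∀ i j : Fin (n + 1), B (chevH i) (chevH j) = cartan n i j
  e_f : ∀ i j : Fin (n + 1), B (chevE i) (chevF j) = if i = j then 1 else 0
  e_e : ∀ i j : Fin (n + 1), B (chevE i) (chevE j) = 0
  f_f : ∀ i j : Fin (n + 1), B (chevF i) (chevF j) = 0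
  invariant : ∀ x y z : U n, B ⁅x, y⁆ z = B x ⁅y, z⁆
  supersymm : ∀ p q : ℤ, ∀ x ∈ level n p, ∀ y ∈ level n q, B x y = koszulSign p q * B y x
  graded : ∀ p q : ℤ, p + q ≠ 0 → ∀ x ∈ level n p, ∀ y ∈ level n q, B x y = 0

open scoped Classical in
/-- The bilinear form `⟨x | y⟩` of `U_{n+1}`: the form with the properties above (it exists and
is unique). -/
noncomputable def form (n : ℕ) : U n →ₗ[ℝ] U n →ₗ[ℝ] ℝ :=
  if hB : ∃ B, IsInvariantForm n B then hB.choose else 0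

/-! ### Multi-index tensors

A tensor with `k` indices in a finite set `ι` is a function on `Fin k → ι`. A matrix `Q` on such
multi-indices is written `Q_{M₁…M_k}^{N₁…N_k}`: lower indices are rows, upper ones columns. -/

/-- The iterated bracket `⟦v_{M₁}, ⟦v_{M₂}, …, ⟦v_{M_{k-1}}, v_{M_k}⟧…⟧⟧`. -/
noncomputable def nested {n : ℕ} {ι : Type*} (v : ι → U n) : (k : ℕ) → (Fin k → ι) → U n
  | 0, _ => 0
  | 1, M => v (M 0)
  | k + 2, M => ⁅v (M 0), nested v (k + 1) (Fin.tail M)⁆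

open scoped Classical in
/-- `x_{N₁}^{P₁} δ_{N₂}^{P₂}⋯δ_{N_k}^{P_k} + … + δ_{N₁}^{P₁}⋯δ_{N_{k-1}}^{P_{k-1}} x_{N_k}^{P_k}`. -/
noncomputable def derivation {ι V : Type*} [AddCommMonoid V] (x : ι → ι → V) {k : ℕ}
    (N P : Fin k → ι) : V :=
  ∑ i, if ∀ j, j ≠ i → N j = P j then x (N i) (P i) else 0

/-- Projection `T^{⟨N₁…N_k⟩}` of the upper indices with the matrix `Q`. -/
noncomputable def projUpper {ι V : Type*} [Fintype ι] [AddCommMonoid V] [Module ℝ V] {k : ℕ}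
    (Q : Matrix (Fin k → ι) (Fin k → ι) ℝ) (T : (Fin k → ι) → V) (N : Fin k → ι) : V :=
  ∑ M, Q M N • T M

section LevelSide

variable {n : ℕ} {ι : Type*} [Fintype ι]

/-- The basis elements `E_M` of level `-1` as elements of the algebra, and their iterated brackets
`E_{M₁…M_k}`. -/
noncomputable def nestedE (E : Module.Basis ι ℝ (level n (-1))) {k : ℕ} (M : Fin k → ι) : U n :=
  nested (fun m => (E m : U n)) k M

/-- The basis elements `F^M` of level `1` and their iterated brackets `F^{M₁…M_k}`. -/
noncomputable def nestedF (F : Module.Basis ι ℝ (level n 1)) {k : ℕ} (M : Fin k → ι) : U n :=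
  nested (fun m => (F m : U n)) k M

/-- `Q` is the projector on the representation `s_k` of level `k`: it is idempotent, it kills
exactly the coefficient tensors `c` with `c^{M₁…M_k} E_{M₁…M_k} = 0` when these are contracted with
its lower indices, and exactly the tensors `d` with `d_{N₁…N_k} F^{N₁…N_k} = 0` when these are
contracted with its upper indices. (There is at most one such matrix.) -/
structure IsLevelProjector (E : Module.Basis ι ℝ (level n (-1))) (F : Module.Basis ι ℝ (level n 1))
    (k : ℕ) (Q : Matrix (Fin k → ι) (Fin k → ι) ℝ) : Prop where
  idempotent : Q * Q = Q
  lower : ∀ c : (Fin k → ι) → ℝ, Matrix.vecMul c Q = 0 ↔ ∑ M, c M • nestedE E M = 0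
  upper : ∀ d : (Fin k → ι) → ℝ, Matrix.mulVec Q d = 0 ↔ ∑ N, d N • nestedF F N = 0

/-- `Y^{N₁…N_k}_{M₁…M_{k+1}} = (1/a_k) ⟦F^{N₁…N_k}, E_{M₁…M_{k+1}}⟧`. -/
noncomputable def elementY (E : Module.Basis ι ℝ (level n (-1)))
    (F : Module.Basis ι ℝ (level n 1)) (a : ℕ → ℝ) {k : ℕ} (N : Fin k → ι)
    (M : Fin (k + 1) → ι) : U n :=
  (a k)⁻¹ • ⁅nestedF F N, nestedE E M⁆

/-- `X_{M|N₁…N_k}^{P₁…P_k} = (1/a_k) ⟦E_M, ⟦E_{N₁…N_k}, F^{P₁…P_k}⟧⟧`. -/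
noncomputable def elementX (E : Module.Basis ι ℝ (level n (-1)))
    (F : Module.Basis ι ℝ (level n 1)) (a : ℕ → ℝ) (m : ι) {k : ℕ} (N P : Fin k → ι) : U n :=
  (a k)⁻¹ • ⁅(E m : U n), ⁅nestedE E N, nestedF F P⁆⁆

/-- The lower-index tensors that `s_k` admits, i.e. the representation conjugate to `s_k` as a
subspace of the `k`-th tensor power of the representation conjugate to `s_1`: all tensors
`M ↦ φ(E_{M₁…M_k})` with a linear functional `φ`. -/
noncomputable def levelRep (E : Module.Basis ι ℝ (level n (-1))) (k : ℕ) :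
    Submodule ℝ ((Fin k → ι) → ℝ) :=
  Submodule.span ℝ {T | ∃ φ : U n →ₗ[ℝ] ℝ, T = fun M => φ (nestedE E M)}

end LevelSide

/-! ### The tensor hierarchy -/

section HierarchySide

variable {n : ℕ} {ι : Type*} [Fintype ι]

/-- The matrix `t_N^P` of `t ∈ E_n` in the representation `r_1 = s_1`:
`[t, E_N] = ∑_P t_N^P E_P`. -/
noncomputable def repMatrix (E : Module.Basis ι ℝ (level n (-1))) (t : En n) (N P : ι) : ℝ :=
  E.repr ⟨⁅(t : U n), (E N : U n)⁆, by
    simpa using bracket_mem_level (En_le_level_zero n t.2) (E N).2⟩ P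

/-- A representation constraint: a subspace of the space of all embedding tensors
`X_M = Θ_M^α t_α` (families of elements of `E_n`) that is invariant under `E_n`. -/
def IsRepConstraint (E : Module.Basis ι ℝ (level n (-1))) (R : Submodule ℝ (ι → En n)) : Prop :=
  ∀ t : En n, ∀ X ∈ R, (fun M => ⁅t, X M⁆ - ∑ P, repMatrix E t M P • X P) ∈ R

open scoped Classical in
/-- The intertwiners `Y^{N₁…N_k}_{M₁…M_{k+1}}` of the tensor hierarchy: the recursion formula for
`k ≥ 2`, where `Pr k` is the projector on `r_k`, and the initial condition for `k = 1`. -/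
noncomputable def hierarchyY (E : Module.Basis ι ℝ (level n (-1)))
    (Pr : (k : ℕ) → Matrix (Fin k → ι) (Fin k → ι) ℝ) (X : ι → En n) :
    (k : ℕ) → (Fin k → ι) → (Fin (k + 1) → ι) → ℝ
  | 0, _, _ => 0
  | 1, P, M => - repMatrix E (X (M 0)) (M 1) (P 0) - repMatrix E (X (M 1)) (M 0) (P 0)
  | k + 2, N, M =>
      - projUpper (Pr (k + 2)) (fun Q => if M 0 = Q 0 then
          hierarchyY E Pr X (k + 1) (Fin.tail Q) (Fin.tail M) else 0) N
      - projUpper (Pr (k + 2)) (fun Q => derivation (repMatrix E (X (M 0))) (Fin.tail M) Q) N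

/-- The lower-index tensors of the hierarchy, i.e. the representation conjugate to `r_k` as a
subspace of the `k`-th tensor power of the representation conjugate to `r_1`: for `k ≥ 2` the span
of the lower-index tensors of the intertwiners `Y^{N₁…N_{k-1}}_{M₁…M_k}`, where the embedding tensor
ranges over the representation constraint. -/
noncomputable def hierarchyRep (E : Module.Basis ι ℝ (level n (-1)))
    (R : Submodule ℝ (ι → En n)) (Pr : (k : ℕ) → Matrix (Fin k → ι) (Fin k → ι) ℝ) :
    (k : ℕ) → Submodule ℝ ((Fin k → ι) → ℝ)
  | 0 => ⊤
  | 1 => ⊤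
  | k + 2 => Submodule.span ℝ {T | ∃ X ∈ R, ∃ N : Fin (k + 1) → ι, T = hierarchyY E Pr X (k + 1) N}

/-- `Pr k` is, for every `k ≥ 2`, a projector on `r_k` in the `k`-th tensor power of `r_1`: it is
idempotent, commutes with `E_n`, and contracting its lower indices with a coefficient tensor `c`
gives zero if and only if `c` is annihilated by all lower-index tensors of `r_k`. -/
structure IsHierarchyProjector (E : Module.Basis ι ℝ (level n (-1)))
    (R : Submodule ℝ (ι → En n)) (Pr : (k : ℕ) → Matrix (Fin k → ι) (Fin k → ι) ℝ) : Prop where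
  idempotent : ∀ k, 2 ≤ k → Pr k * Pr k = Pr k
  equivariant : ∀ k, 2 ≤ k → ∀ t : En n,
    Pr k * Matrix.of (derivation (repMatrix E t)) = Matrix.of (derivation (repMatrix E t)) * Pr k
  lower : ∀ k, 2 ≤ k → ∀ c : (Fin k → ι) → ℝ,
    Matrix.vecMul c (Pr k) = 0 ↔ ∀ T ∈ hierarchyRep E R Pr k, ∑ M, c M * T M = 0

end HierarchySide

end Borcherds

open Borcherds

namespace Borcherds

/-! ### Linear algebra -/

/-! The recursion formulas follow from the Jacobi identity and the invariance of the form. An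
element s of level 0 acts on E_{N₁…N_k} as a derivation, and ⟨s|⟦E_N,F^P⟧⟩ = ⟨[s,E_N]|F^P⟩. So
⟦E_N,F^P⟧/a_k and the projected sum of the ⟦E_{N_i},F^{P_i}⟧ pair equally with level 0, and their
difference commutes with level -1 because levels -1 and 1 are dual (`elementX_eq`). For Y, the
Jacobi identity splits ⟦F^N,⟦E_{M₁},E_{M₂…}⟧⟧, and ⟦F^N,E_m⟧ is found by pairing it with the
opposite level (`bracket_nestedF_E`, `elementY_eq`).

For the inclusion, an embedding tensor X suggests an odd derivation D from the negative levels into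
U with E_M ↦ -X_M, raising the level by one. On {E_M,E_N} it gives Y^P_{MN} E_P, and the recursion
for Y is the Leibniz rule for D followed by the projection on r_k (`IntertwinerFormula.succ`). If D
is well defined, i.e. if c·E_{M…} = 0 implies c·D(E_{M…}) = 0, then such c annihilate Y as well, so
the lower-index tensors of Y are linear functionals of E_{M…}.

D is well defined for three reasons. First, all relations among iterated brackets of the E_M follow
from those at level -2: U acts on the quadratic algebra with these relations, E_M by left
multiplication (`exists_quadAlg_representation`, `sum_qnested_eq_zero`). Secondly, r_2 = s_2 makes D
respect the relations at level -2. Testing D through the adjoint action then shows that c·D(E_{M…})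
commutes with everything (`bracket_sum_embeddingDer`). Thirdly, such elements vanish at levels -2,
…, -p, where the form is nondegenerate (`IsProjectorForm.eq_zero_of_forall_bracket`). Since D maps
level -(p+1) to level -p, the argument reaches k = p+1. -/

theorem exists_comp_eq_of_ker_le {V W Z : Type*} [AddCommGroup V] [AddCommGroup W]
    [AddCommGroup Z] [Module ℝ V] [Module ℝ W] [Module ℝ Z] (f : V →ₗ[ℝ] W) (g : V →ₗ[ℝ] Z)
    (h : ∀ v, f v = 0 → g v = 0) : ∃ φ : W →ₗ[ℝ] Z, ∀ v, φ (f v) = g v := by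
  obtain ⟨φ, hφ⟩ := LinearMap.exists_extend
    (((LinearMap.ker f).liftQ g fun v hv => h v hv) ∘ₗ f.quotKerEquivRange.symm.toLinearMap)
  refine ⟨φ, fun v => ?_⟩
  have := LinearMap.congr_fun hφ ⟨f v, LinearMap.mem_range_self f v⟩
  simp only [LinearMap.comp_apply, Submodule.subtype_apply, LinearEquiv.coe_coe] at this
  rw [this, LinearMap.quotKerEquivRange_symm_apply_image f v (LinearMap.mem_range_self f v)]
  exact Submodule.liftQ_apply _ _ _

/-! ### The superbracket -/

section Bracket

variable {n : ℕ}

@[simp] theorem bracket_add (x y z : U n) : ⁅x, y + z⁆ = ⁅x, y⁆ + ⁅x, z⁆ :=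
  (bracketHom n x).map_add y z

@[simp] theorem add_bracket (x y z : U n) : ⁅x + y, z⁆ = ⁅x, z⁆ + ⁅y, z⁆ :=
  (bracketHom n).map_add₂ x y z

@[simp] theorem bracket_smul (c : ℝ) (x y : U n) : ⁅x, c • y⁆ = c • ⁅x, y⁆ :=
  (bracketHom n x).map_smul c y

@[simp] theorem smul_bracket (c : ℝ) (x y : U n) : ⁅c • x, y⁆ = c • ⁅x, y⁆ :=
  (bracketHom n).map_smul₂ c x y

@[simp] theorem bracket_neg (x y : U n) : ⁅x, -y⁆ = -⁅x, y⁆ := (bracketHom n x).map_neg y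

@[simp] theorem neg_bracket (x y : U n) : ⁅-x, y⁆ = -⁅x, y⁆ := (bracketHom n).map_neg₂ x y

@[simp] theorem bracket_sub (x y z : U n) : ⁅x, y - z⁆ = ⁅x, y⁆ - ⁅x, z⁆ :=
  (bracketHom n x).map_sub y z

@[simp] theorem sub_bracket (x y z : U n) : ⁅x - y, z⁆ = ⁅x, z⁆ - ⁅y, z⁆ :=
  (bracketHom n).map_sub₂ x y z

@[simp] theorem bracket_zero (x : U n) : ⁅x, (0 : U n)⁆ = 0 := (bracketHom n x).map_zero

@[simp] theorem zero_bracket (x : U n) : ⁅(0 : U n), x⁆ = 0 := (bracketHom n).map_zero₂ x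

@[simp] theorem bracket_sum {κ : Type*} (s : Finset κ) (x : U n) (y : κ → U n) :
    ⁅x, ∑ k ∈ s, y k⁆ = ∑ k ∈ s, ⁅x, y k⁆ := map_sum (bracketHom n x) y s

@[simp] theorem sum_bracket {κ : Type*} (s : Finset κ) (x : κ → U n) (y : U n) :
    ⁅∑ k ∈ s, x k, y⁆ = ∑ k ∈ s, ⁅x k, y⁆ := (bracketHom n).map_sum₂ s x y

theorem mk_eq_zero_of_isRelator {x : FreeAlg n} (hx : IsRelator n x) : mk n x = 0 := by
  refine (Submodule.Quotient.mk_eq_zero (relIdeal n)).2 ?_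
  simp only [relIdeal, Submodule.mem_sInf]
  exact fun I hI => hI.1 x hx

theorem span_word (n : ℕ) : Submodule.span ℝ (Set.range (word (n := n))) = ⊤ := by
  refine eq_top_iff.2 fun x _ => ?_
  induction x using MonoidAlgebra.induction_linear with
  | zero => exact zero_mem _
  | add f g hf hg => exact add_mem (hf trivial) (hg trivial)
  | single w c =>
    have : (MonoidAlgebra.single w c : FreeAlg n) = c • word w := by
      simp [word]
    rw [this]
    exact Submodule.smul_mem _ _ (Submodule.subset_span ⟨w, rfl⟩)

theorem word_mul (u v : FreeMagma (Gen n)) : word (u * v) = word u * word v := by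
  simp only [word, MonoidAlgebra.single_mul_single, mul_one]

theorem span_mk_word (n : ℕ) :
    Submodule.span ℝ (Set.range fun w => mk n (word w)) = ⊤ := by
  have : (Set.range fun w => mk n (word w)) = mk n '' Set.range word := by
    rw [← Set.range_comp]; rfl
  rw [this, Submodule.span_image, span_word, Submodule.map_top]
  exact Submodule.range_mkQ _

theorem bracket_skew {p q : ℤ} {x y : U n} (hx : x ∈ level n p) (hy : y ∈ level n q) :
    ⁅x, y⁆ = -(koszulSign p q • ⁅y, x⁆) := by
  induction hx using Submodule.span_induction with
  | zero => simp
  | add a b _ _ ha hb => rw [add_bracket, bracket_add, ha, hb]; module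
  | smul c a _ ha => rw [smul_bracket, bracket_smul, ha]; module
  | mem a ha =>
    obtain ⟨u, rfl, rfl⟩ := ha
    induction hy using Submodule.span_induction with
    | zero => simp
    | add a b _ _ ha hb => rw [add_bracket, bracket_add, ha, hb]; module
    | smul c a _ ha => rw [smul_bracket, bracket_smul, ha]; module
    | mem b hb =>
      obtain ⟨v, rfl, rfl⟩ := hb
      have := mk_eq_zero_of_isRelator (IsRelator.skew u v)
      rw [map_add, map_smul, mk_mul, mk_mul] at this
      exact eq_neg_of_add_eq_zero_left this

/-- The sign involves only the levels of `x` and `y`, so `z` need not be homogeneous. -/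
theorem bracket_jacobi {p q : ℤ} {x y : U n} (hx : x ∈ level n p) (hy : y ∈ level n q)
    (z : U n) : ⁅⁅x, y⁆, z⁆ = ⁅x, ⁅y, z⁆⁆ - koszulSign p q • ⁅y, ⁅x, z⁆⁆ := by
  induction hx using Submodule.span_induction with
  | zero => simp
  | add a b _ _ ha hb => simp only [add_bracket, bracket_add, ha, hb]; module
  | smul c a _ ha => simp only [smul_bracket, bracket_smul, ha]; module
  | mem a ha =>
    obtain ⟨u, rfl, rfl⟩ := ha
    induction hy using Submodule.span_induction with
    | zero => simp
    | add a b _ _ ha hb => simp only [add_bracket, bracket_add, ha, hb]; module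
    | smul c a _ ha => simp only [smul_bracket, bracket_smul, ha]; module
    | mem b hb =>
      obtain ⟨v, rfl, rfl⟩ := hb
      have hz : z ∈ Submodule.span ℝ (Set.range fun w => mk n (word w)) := by
        rw [span_mk_word]; trivial
      induction hz using Submodule.span_induction with
      | zero => simp
      | add a b _ _ ha hb => simp only [bracket_add, ha, hb]; module
      | smul c a _ ha => simp only [bracket_smul, ha]; module
      | mem c hc =>
        obtain ⟨w, rfl⟩ := hc
        have := mk_eq_zero_of_isRelator (IsRelator.jacobi u v w)
        simp only [map_add, map_sub, map_smul, mk_mul] at this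
        rw [← sub_eq_zero, ← this]; abel

theorem koszulSign_comm (p q : ℤ) : koszulSign p q = koszulSign q p := by
  simp only [koszulSign, and_comm]

theorem koszulSign_of_even_left {p : ℤ} (hp : Even p) (q : ℤ) : koszulSign p q = 1 := by
  rw [koszulSign, if_neg]
  exact fun h => Int.not_even_iff_odd.2 h.1 hp

theorem koszulSign_of_odd {p q : ℤ} (hp : Odd p) (hq : Odd q) : koszulSign p q = -1 :=
  if_pos ⟨hp, hq⟩

@[simp] theorem koszulSign_zero_left (q : ℤ) : koszulSign 0 q = 1 :=
  koszulSign_of_even_left (by simp) q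

@[simp] theorem koszulSign_zero_right (q : ℤ) : koszulSign q 0 = 1 := by
  rw [koszulSign_comm, koszulSign_zero_left]

theorem koszulSign_mul_self (p q : ℤ) : koszulSign p q * koszulSign p q = 1 := by
  unfold koszulSign; split_ifs <;> norm_num

theorem bracket_skew_zero {p : ℤ} {x y : U n} (hx : x ∈ level n 0) (hy : y ∈ level n p) :
    ⁅x, y⁆ = -⁅y, x⁆ := by
  simpa using bracket_skew hx hy

theorem bracket_comm_of_odd {p q : ℤ} (hp : Odd p) (hq : Odd q) {x y : U n} (hx : x ∈ level n p)
    (hy : y ∈ level n q) : ⁅x, y⁆ = ⁅y, x⁆ := by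
  simpa [koszulSign_of_odd hp hq] using bracket_skew hx hy

theorem bracket_jacobi_zero {p : ℤ} {x y : U n} (hx : x ∈ level n 0) (hy : y ∈ level n p)
    (z : U n) : ⁅x, ⁅y, z⁆⁆ = ⁅⁅x, y⁆, z⁆ + ⁅y, ⁅x, z⁆⁆ := by
  rw [bracket_jacobi hx hy]; simp

theorem bracket_jacobi' {p q : ℤ} {x y : U n} (hx : x ∈ level n p) (hy : y ∈ level n q) (z : U n) :
    ⁅x, ⁅y, z⁆⁆ = ⁅⁅x, y⁆, z⁆ + koszulSign p q • ⁅y, ⁅x, z⁆⁆ := by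
  rw [bracket_jacobi hx hy]; simp

end Bracket

/-! ### Generation by the local part -/

section Local

variable {n : ℕ}

/-- Two levels such that these levels and their sum belong to the local part. -/
def LocalPair (p q : ℤ) : Prop := |p| ≤ 1 ∧ |q| ≤ 1 ∧ |p + q| ≤ 1

/-- A graded family of subspaces of the local part that contains the generators and is closed
under those brackets that stay in the local part. -/
structure IsLocalSubalgebra (C : ℤ → Submodule ℝ (U n)) : Prop where
  le_level : ∀ p, C p ≤ level n p
  gen_mem : ∀ g : Gen n, mk n (gen g) ∈ C g.level
  bracket_mem : ∀ p q, LocalPair p q → ∀ x ∈ C p, ∀ y ∈ C q, ⁅x, y⁆ ∈ C (p + q)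

/-- The subspaces spanned by iterated brackets of elements of `C₁`. -/
noncomputable def iterBracket (C₁ C₀ : Submodule ℝ (U n)) : ℕ → Submodule ℝ (U n)
  | 0 => C₀
  | 1 => C₁
  | k + 2 => Submodule.map₂ (bracketHom n) C₁ (iterBracket C₁ C₀ (k + 1))

variable {C : ℤ → Submodule ℝ (U n)}

theorem IsLocalSubalgebra.iterBracket_le_level (hC : IsLocalSubalgebra C) {σ : ℤ} :
    ∀ k : ℕ, iterBracket (C σ) (C 0) k ≤ level n (k * σ)
  | 0 => by simpa [iterBracket] using hC.le_level 0
  | 1 => by simpa [iterBracket] using hC.le_level σ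
  | k + 2 => by
    refine Submodule.map₂_le.2 fun x hx y hy => ?_
    have := bracket_mem_level (hC.le_level σ hx) (hC.iterBracket_le_level (k + 1) hy)
    rwa [show ((k + 2 : ℕ) : ℤ) * σ = σ + (k + 1 : ℕ) * σ by push_cast; ring]

theorem IsLocalSubalgebra.bracket_zero_mem (hC : IsLocalSubalgebra C) {σ : ℤ} (hσ : |σ| ≤ 1)
    {s : U n} (hs : s ∈ C 0) :
    ∀ k : ℕ, ∀ y ∈ iterBracket (C σ) (C 0) k, ⁅s, y⁆ ∈ iterBracket (C σ) (C 0) k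
  | 0, y, hy => by
    have := hC.bracket_mem 0 0 ⟨by simp, by simp, by simp⟩ s hs y hy
    rwa [add_zero] at this
  | 1, y, hy => by
    have := hC.bracket_mem 0 σ ⟨by simp, hσ, by simpa using hσ⟩ s hs y hy
    rwa [zero_add] at this
  | k + 2, y, hy => by
    have H : iterBracket (C σ) (C 0) (k + 2) ≤
        (iterBracket (C σ) (C 0) (k + 2)).comap (bracketHom n s) := by
      refine Submodule.map₂_le.2 fun x hx z hz => ?_
      rw [Submodule.mem_comap, bracketHom_apply, bracketHom_apply,
        bracket_jacobi_zero (hC.le_level 0 hs) (hC.le_level σ hx)]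
      refine add_mem (Submodule.apply_mem_map₂ _ ?_ hz) (Submodule.apply_mem_map₂ _ hx ?_)
      · have := hC.bracket_mem 0 σ ⟨by simp, hσ, by simpa using hσ⟩ s hs x hx
        rwa [zero_add] at this
      · exact hC.bracket_zero_mem hσ hs (k + 1) z hz
    exact H hy

theorem IsLocalSubalgebra.bracket_same_mem (hC : IsLocalSubalgebra C) {σ : ℤ} (hσ : |σ| ≤ 1)
    {x : U n} (hx : x ∈ C σ) (k : ℕ) (y : U n) (hy : y ∈ iterBracket (C σ) (C 0) k) :
    ⁅x, y⁆ ∈ iterBracket (C σ) (C 0) (k + 1) := by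
  cases k with
  | zero =>
    have := hC.bracket_mem σ 0 ⟨hσ, by simp, by simpa using hσ⟩ x hx y hy
    rwa [add_zero] at this
  | succ k => exact Submodule.apply_mem_map₂ _ hx hy

/-- Moving `x` past the leading factor leaves a bracket in `C 0`, which preserves every
iterated-bracket space, and a shorter instance of the same claim. -/
theorem IsLocalSubalgebra.bracket_opp_mem (hC : IsLocalSubalgebra C) {σ : ℤ} (hσ : |σ| ≤ 1)
    {x : U n} (hx : x ∈ C (-σ)) :
    ∀ k : ℕ, ∀ y ∈ iterBracket (C σ) (C 0) (k + 1), ⁅x, y⁆ ∈ iterBracket (C σ) (C 0) k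
  | 0, y, hy => by
    have := hC.bracket_mem (-σ) σ ⟨by simpa using hσ, hσ, by simp⟩ x hx y hy
    rwa [neg_add_cancel] at this
  | k + 1, y, hy => by
    have H : iterBracket (C σ) (C 0) (k + 2) ≤
        (iterBracket (C σ) (C 0) (k + 1)).comap (bracketHom n x) := by
      refine Submodule.map₂_le.2 fun v hv z hz => ?_
      rw [Submodule.mem_comap, bracketHom_apply, bracketHom_apply,
        bracket_jacobi' (hC.le_level _ hx) (hC.le_level σ hv)]
      refine add_mem ?_ (Submodule.smul_mem _ _ ?_)
      · have := hC.bracket_mem (-σ) σ ⟨by simpa using hσ, hσ, by simp⟩ x hx v hv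
        rw [neg_add_cancel] at this
        exact hC.bracket_zero_mem hσ this _ _ hz
      · exact hC.bracket_same_mem hσ hv k _ (hC.bracket_opp_mem hσ hx k z hz)
    exact H hy

/-- The graded family spanned by iterated brackets, on all levels. -/
noncomputable def localHull (C : ℤ → Submodule ℝ (U n)) : ℤ → Submodule ℝ (U n)
  | .ofNat k => iterBracket (C 1) (C 0) k
  | .negSucc k => iterBracket (C (-1)) (C 0) (k + 1)

theorem localHull_natCast (k : ℕ) : localHull C k = iterBracket (C 1) (C 0) k := rfl

theorem localHull_neg_natCast : ∀ k : ℕ, localHull C (-k) = iterBracket (C (-1)) (C 0) k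
  | 0 => rfl
  | _ + 1 => rfl

theorem IsLocalSubalgebra.bracket_zero_mem_localHull (hC : IsLocalSubalgebra C) {s : U n}
    (hs : s ∈ C 0) (j : ℤ) (y : U n) (hy : y ∈ localHull C j) : ⁅s, y⁆ ∈ localHull C j := by
  cases j with
  | ofNat k => exact hC.bracket_zero_mem (by simp) hs k y hy
  | negSucc k => exact hC.bracket_zero_mem (by simp) hs (k + 1) y hy

theorem IsLocalSubalgebra.bracket_one_mem_localHull (hC : IsLocalSubalgebra C) {x : U n}
    (hx : x ∈ C 1) (j : ℤ) (y : U n) (hy : y ∈ localHull C j) : ⁅x, y⁆ ∈ localHull C (j + 1) := by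
  cases j with
  | ofNat k => exact hC.bracket_same_mem (by simp) hx k y hy
  | negSucc k =>
    have := hC.bracket_opp_mem (σ := -1) (by simp) (by simpa using hx) k y hy
    rwa [← localHull_neg_natCast, show -(k : ℤ) = Int.negSucc k + 1 by
      rw [Int.negSucc_eq]; ring] at this

theorem IsLocalSubalgebra.bracket_neg_one_mem_localHull (hC : IsLocalSubalgebra C) {x : U n}
    (hx : x ∈ C (-1)) (j : ℤ) (y : U n) (hy : y ∈ localHull C j) :
    ⁅x, y⁆ ∈ localHull C (j + -1) := by
  obtain ⟨k, rfl | rfl⟩ := j.eq_nat_or_neg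
  · cases k with
    | zero => exact hC.bracket_same_mem (σ := -1) (by simp) hx 0 y hy
    | succ k =>
      have := hC.bracket_opp_mem (σ := 1) (by simp) hx k y hy
      rwa [← localHull_natCast, show (k : ℤ) = ((k + 1 : ℕ) : ℤ) + -1 by push_cast; ring] at this
  · rw [localHull_neg_natCast] at hy
    have := hC.bracket_same_mem (σ := -1) (by simp) hx k y hy
    rwa [← localHull_neg_natCast, show -((k + 1 : ℕ) : ℤ) = -(k : ℤ) + -1 by
      push_cast; ring] at this

theorem Gen.level_cases (g : Gen n) : g.level = 0 ∨ g.level = 1 ∨ g.level = -1 := by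
  cases g <;> simp only [Gen.level] <;> try split_ifs
  all_goals simp

theorem IsLocalSubalgebra.bracket_gen_mem_localHull (hC : IsLocalSubalgebra C) (g : Gen n) (j : ℤ)
    (y : U n) (hy : y ∈ localHull C j) : ⁅Borcherds.mk n (gen g), y⁆ ∈ localHull C (j + g.level) := by
  have hg := hC.gen_mem g
  rcases g.level_cases with h | h | h <;> rw [h] at hg ⊢
  · rw [add_zero]; exact hC.bracket_zero_mem_localHull hg j y hy
  · exact hC.bracket_one_mem_localHull hg j y hy
  · exact hC.bracket_neg_one_mem_localHull hg j y hy

/-- The adjoint action of a bracket is the super commutator of the adjoint actions, so stability of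
the hull under generators suffices. -/
theorem IsLocalSubalgebra.bracket_word_mem_localHull (hC : IsLocalSubalgebra C) :
    ∀ (w : FreeMagma (Gen n)) (j : ℤ), ∀ y ∈ localHull C j,
      ⁅Borcherds.mk n (word w), y⁆ ∈ localHull C (j + wordLevel w)
  | .of g, j, y, hy => hC.bracket_gen_mem_localHull g j y hy
  | .mul u v, j, y, hy => by
    have hu := hC.bracket_word_mem_localHull u
    have hv := hC.bracket_word_mem_localHull v
    have e : Borcherds.mk n (word (FreeMagma.mul u v)) =
        ⁅Borcherds.mk n (word u), Borcherds.mk n (word v)⁆ := by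
      rw [← mk_mul, ← word_mul]; rfl
    rw [e, bracket_jacobi (mk_word_mem u) (mk_word_mem v)]
    refine sub_mem ?_ (Submodule.smul_mem _ _ ?_)
    · have := hu _ _ (hv j y hy)
      rwa [show j + wordLevel (FreeMagma.mul u v) = j + wordLevel v + wordLevel u by
        simp only [wordLevel]; ring]
    · have := hv _ _ (hu j y hy)
      rwa [show j + wordLevel (FreeMagma.mul u v) = j + wordLevel u + wordLevel v by
        simp only [wordLevel]; ring]

theorem localHull_of_abs_le (p : ℤ) (hp : |p| ≤ 1) :
    localHull C p = C p := by
  obtain ⟨h1, h2⟩ := abs_le.1 hp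
  interval_cases p <;> rfl

theorem IsLocalSubalgebra.word_mem_localHull (hC : IsLocalSubalgebra C) :
    ∀ w : FreeMagma (Gen n), Borcherds.mk n (word w) ∈ localHull C (wordLevel w)
  | .of g => by
    have hl : |g.level| ≤ 1 := by rcases g.level_cases with h | h | h <;> simp [h]
    show _ ∈ localHull C g.level
    rw [localHull_of_abs_le _ hl]
    exact hC.gen_mem g
  | .mul u v => by
    have := hC.bracket_word_mem_localHull u _ _ (hC.word_mem_localHull v)
    rw [← mk_mul, ← word_mul] at this
    rwa [show wordLevel (FreeMagma.mul u v) = wordLevel v + wordLevel u from add_comm _ _]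

theorem IsLocalSubalgebra.level_le_localHull (hC : IsLocalSubalgebra C) (p : ℤ) :
    level n p ≤ localHull C p := by
  refine Submodule.span_le.2 ?_
  rintro _ ⟨w, rfl, rfl⟩
  exact hC.word_mem_localHull w

/-- A graded property that holds for the generators and passes to brackets within the local part
therefore holds on all of levels -1, 0, 1. This reaches the E_M, which arise from words of any
length. -/
theorem IsLocalSubalgebra.eq_level (hC : IsLocalSubalgebra C) (p : ℤ) (hp : |p| ≤ 1) :
    C p = level n p :=
  le_antisymm (hC.le_level p)
    ((hC.level_le_localHull p).trans (localHull_of_abs_le p hp).le)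

theorem isLocalSubalgebra_level (n : ℕ) : IsLocalSubalgebra (level n) where
  le_level _ := le_rfl
  gen_mem g := mk_word_mem (.of g)
  bracket_mem _ _ _ _ hx _ hy := bracket_mem_level hx hy

theorem iterBracket_span {ι : Type*} (v : ι → U n) (C₁ C₀ : Submodule ℝ (U n))
    (hv : C₁ = Submodule.span ℝ (Set.range v)) :
    ∀ k : ℕ, iterBracket C₁ C₀ (k + 1) = Submodule.span ℝ (Set.range (nested v (k + 1)))
  | 0 => by
    rw [iterBracket, hv]
    congr 1
    ext x
    exact ⟨fun ⟨i, hi⟩ => ⟨fun _ => i, hi⟩, fun ⟨M, hM⟩ => ⟨M 0, hM⟩⟩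
  | k + 1 => by
    rw [iterBracket, iterBracket_span v C₁ C₀ hv k, hv, Submodule.map₂_span_span]
    congr 1
    ext x
    constructor
    · rintro ⟨_, ⟨i, rfl⟩, _, ⟨M, rfl⟩, rfl⟩
      exact ⟨Fin.cons i M, rfl⟩
    · rintro ⟨M, rfl⟩
      exact ⟨_, ⟨M 0, rfl⟩, _, ⟨Fin.tail M, rfl⟩, rfl⟩

theorem span_range_basis {ι : Type*} {p : ℤ} (b : Module.Basis ι ℝ (level n p)) :
    level n p = Submodule.span ℝ (Set.range fun i => (b i : U n)) := by
  have := congrArg (Submodule.map (level n p).subtype) b.span_eq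
  rw [Submodule.map_span, Submodule.map_top, Submodule.range_subtype, ← Set.range_comp] at this
  exact this.symm

theorem level_neg_le_span {ι : Type*} (E : Module.Basis ι ℝ (level n (-1))) (k : ℕ) :
    level n (-(k + 1 : ℕ)) ≤
      Submodule.span ℝ (Set.range fun M : Fin (k + 1) → ι => nestedE E M) := by
  refine ((isLocalSubalgebra_level n).level_le_localHull _).trans ?_
  rw [localHull_neg_natCast, iterBracket_span _ _ _ (span_range_basis E)]
  rfl

theorem level_natCast_le_span {ι : Type*} (F : Module.Basis ι ℝ (level n 1)) (k : ℕ) :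
    level n (k + 1 : ℕ) ≤
      Submodule.span ℝ (Set.range fun M : Fin (k + 1) → ι => nestedF F M) := by
  refine ((isLocalSubalgebra_level n).level_le_localHull _).trans ?_
  rw [localHull_natCast, iterBracket_span _ _ _ (span_range_basis F)]
  rfl

theorem nested_mem_level {ι : Type*} {v : ι → U n} {σ : ℤ} (hv : ∀ i, v i ∈ level n σ) :
    ∀ (k : ℕ) (M : Fin k → ι), nested v k M ∈ level n (k * σ)
  | 0, _ => zero_mem _
  | 1, M => by simpa [nested] using hv (M 0)
  | k + 2, M => by
    have := bracket_mem_level (hv (M 0)) (nested_mem_level hv (k + 1) (Fin.tail M))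
    rwa [nested, show ((k + 2 : ℕ) : ℤ) * σ = σ + (k + 1 : ℕ) * σ by push_cast; ring]

theorem nestedE_mem {ι : Type*} (E : Module.Basis ι ℝ (level n (-1))) {k : ℕ} (M : Fin k → ι) :
    nestedE E M ∈ level n (-k) := by
  simpa [nestedE] using nested_mem_level (fun i => (E i).2) k M

theorem nestedF_mem {ι : Type*} (F : Module.Basis ι ℝ (level n 1)) {k : ℕ} (M : Fin k → ι) :
    nestedF F M ∈ level n k := by
  simpa [nestedF] using nested_mem_level (fun i => (F i).2) k M

end Local

/-! ### Associative algebras with the super commutator -/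

/-- The sum of an even and an odd copy of an associative algebra, multiplied by the
super commutator. -/
def SuperComm (A : Type*) : Type _ := A × A

namespace SuperComm

variable {A : Type*}

/-- The even component. -/
def even (x : SuperComm A) : A := x.1

/-- The odd component. -/
def odd (x : SuperComm A) : A := x.2

/-- The element with given even and odd components. -/
def of (a b : A) : SuperComm A := (a, b)

@[simp] theorem even_of (a b : A) : (of a b).even = a := rfl
@[simp] theorem odd_of (a b : A) : (of a b).odd = b := rfl

@[ext] theorem ext {x y : SuperComm A} (h₁ : x.even = y.even) (h₂ : x.odd = y.odd) : x = y :=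
  Prod.ext h₁ h₂

section Ring

variable [Ring A]

instance : AddCommGroup (SuperComm A) := inferInstanceAs (AddCommGroup (A × A))

/-- This is the super commutator of A[ξ] with ξ odd, ξ² = 1 and ξ commuting with A. Parity is thus
tracked without a grading on A. -/
instance : Mul (SuperComm A) :=
  ⟨fun x y => of (x.even * y.even - y.even * x.even + (x.odd * y.odd + y.odd * x.odd))
    (x.even * y.odd - y.odd * x.even + (x.odd * y.even - y.even * x.odd))⟩

@[simp] theorem even_mul (x y : SuperComm A) :
    (x * y).even = x.even * y.even - y.even * x.even + (x.odd * y.odd + y.odd * x.odd) := rfl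
@[simp] theorem odd_mul (x y : SuperComm A) :
    (x * y).odd = x.even * y.odd - y.odd * x.even + (x.odd * y.even - y.even * x.odd) := rfl
@[simp] theorem even_add (x y : SuperComm A) : (x + y).even = x.even + y.even := rfl
@[simp] theorem odd_add (x y : SuperComm A) : (x + y).odd = x.odd + y.odd := rfl
@[simp] theorem even_zero : (0 : SuperComm A).even = 0 := rfl
@[simp] theorem odd_zero : (0 : SuperComm A).odd = 0 := rfl

instance : NonUnitalNonAssocRing (SuperComm A) where
  left_distrib x y z := by
    ext <;> simp only [even_mul, odd_mul, even_add, odd_add] <;> noncomm_ring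
  right_distrib x y z := by
    ext <;> simp only [even_mul, odd_mul, even_add, odd_add] <;> noncomm_ring
  zero_mul x := by ext <;> simp
  mul_zero x := by ext <;> simp

end Ring

variable [Ring A] [Algebra ℝ A]

instance : Module ℝ (SuperComm A) := inferInstanceAs (Module ℝ (A × A))

@[simp] theorem even_smul (c : ℝ) (x : SuperComm A) : (c • x).even = c • x.even := rfl
@[simp] theorem odd_smul (c : ℝ) (x : SuperComm A) : (c • x).odd = c • x.odd := rfl

instance : IsScalarTower ℝ (SuperComm A) (SuperComm A) where
  smul_assoc c x y := by
    ext <;> simp only [smul_eq_mul, even_mul, odd_mul, even_smul, odd_smul, smul_mul_assoc,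
      mul_smul_comm] <;> module

instance : SMulCommClass ℝ (SuperComm A) (SuperComm A) where
  smul_comm c x y := by
    ext <;> simp only [smul_eq_mul, even_mul, odd_mul, even_smul, odd_smul, smul_mul_assoc,
      mul_smul_comm] <;> module

open scoped Classical in
/-- The copy of an associative algebra whose parity is that of the level `p`. -/
noncomputable def ofLevel (p : ℤ) : A →ₗ[ℝ] SuperComm A where
  toFun a := if Odd p then of 0 a else of a 0
  map_add' a b := by split_ifs <;> ext <;> simp
  map_smul' c a := by split_ifs <;> ext <;> simp

theorem ofLevel_of_odd {p : ℤ} (hp : Odd p) (a : A) : ofLevel p a = of 0 a :=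
  if_pos hp

theorem ofLevel_of_even {p : ℤ} (hp : Even p) (a : A) : ofLevel p a = of a 0 :=
  if_neg fun h => Int.not_even_iff_odd.2 h hp

theorem ofLevel_injective (p : ℤ) : Function.Injective (ofLevel p : A →ₗ[ℝ] SuperComm A) := by
  intro a b hab
  rcases Int.even_or_odd p with hp | hp
  · rw [ofLevel_of_even hp, ofLevel_of_even hp] at hab
    exact congrArg even hab
  · rw [ofLevel_of_odd hp, ofLevel_of_odd hp] at hab
    exact congrArg odd hab

theorem ofLevel_mul (p q : ℤ) (a b : A) :
    ofLevel p a * ofLevel q b = ofLevel (p + q) (a * b - koszulSign p q • (b * a)) := by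
  rcases Int.even_or_odd p with hp | hp <;> rcases Int.even_or_odd q with hq | hq
  · rw [ofLevel_of_even hp, ofLevel_of_even hq, ofLevel_of_even (hp.add hq),
      koszulSign_of_even_left hp]
    ext <;> simp
  · rw [ofLevel_of_even hp, ofLevel_of_odd hq, ofLevel_of_odd (hp.add_odd hq),
      koszulSign_of_even_left hp]
    ext <;> simp
  · rw [ofLevel_of_odd hp, ofLevel_of_even hq, ofLevel_of_odd (hp.add_even hq),
      koszulSign_comm, koszulSign_of_even_left hq]
    ext <;> simp
  · rw [ofLevel_of_odd hp, ofLevel_of_odd hq, ofLevel_of_even (hp.add_odd hq),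
      koszulSign_of_odd hp hq]
    ext <;> simp

theorem ofLevel_mul_of_odd {p q : ℤ} (hp : Odd p) (hq : Odd q) (a b : A) :
    ofLevel p a * ofLevel q b = ofLevel (p + q) (a * b + b * a) := by
  rw [ofLevel_mul, koszulSign_of_odd hp hq, neg_one_smul, sub_neg_eq_add]

theorem koszulSign_add_left (p q r : ℤ) :
    koszulSign (p + q) r = koszulSign p r * koszulSign q r := by
  unfold koszulSign
  rcases Int.even_or_odd p with hp | hp <;> rcases Int.even_or_odd q with hq | hq <;>
    rcases Int.even_or_odd r with hr | hr <;>
    simp_all [Int.even_add, ← Int.not_even_iff_odd]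

end SuperComm

/-! ### The universal property of `U_{n+1}` -/

open SuperComm

section Universal

variable {n : ℕ} {A : Type*} [Ring A] [Algebra ℝ A]

/-- The homomorphism from the free algebra that sends the generators to homogeneous elements. -/
noncomputable def freeLift (a : Gen n → A) : FreeAlg n →ₙₐ[ℝ] SuperComm A :=
  FreeNonUnitalNonAssocAlgebra.lift ℝ fun g => ofLevel g.level (a g)

theorem freeLift_gen (a : Gen n → A) (g : Gen n) :
    freeLift a (gen g) = ofLevel g.level (a g) :=
  FreeNonUnitalNonAssocAlgebra.lift_of_apply ℝ _ g

/-- Images of words are homogeneous with the parity of the word, so the signs in the skew-symmetry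
and Jacobi relators are those of the super commutator. -/
theorem freeLift_word (a : Gen n → A) :
    ∀ w : FreeMagma (Gen n), ∃ b : A, freeLift a (word w) = ofLevel (wordLevel w) b
  | .of g => ⟨a g, freeLift_gen a g⟩
  | .mul u v => by
    obtain ⟨b, hb⟩ := freeLift_word a u
    obtain ⟨c, hc⟩ := freeLift_word a v
    refine ⟨b * c - koszulSign (wordLevel u) (wordLevel v) • (c * b), ?_⟩
    rw [show word (FreeMagma.mul u v) = word u * word v from word_mul u v, map_mul, hb, hc,
      ofLevel_mul]
    rfl

theorem freeLift_skew (a : Gen n → A) (u v : FreeMagma (Gen n)) :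
    freeLift a (word u * word v +
      koszulSign (wordLevel u) (wordLevel v) • (word v * word u)) = 0 := by
  obtain ⟨b, hb⟩ := freeLift_word a u
  obtain ⟨c, hc⟩ := freeLift_word a v
  rw [map_add, map_smul, map_mul, map_mul, hb, hc, ofLevel_mul, ofLevel_mul,
    add_comm (wordLevel v), ← map_smul, ← map_add, koszulSign_comm (wordLevel v)]
  have h := koszulSign_mul_self (wordLevel u) (wordLevel v)
  rw [smul_sub, smul_smul, h]
  simp

theorem freeLift_jacobi (a : Gen n → A) (u v w : FreeMagma (Gen n)) :
    freeLift a ((word u * word v) * word w - word u * (word v * word w) +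
      koszulSign (wordLevel u) (wordLevel v) • (word v * (word u * word w))) = 0 := by
  obtain ⟨b, hb⟩ := freeLift_word a u
  obtain ⟨c, hc⟩ := freeLift_word a v
  obtain ⟨d, hd⟩ := freeLift_word a w
  simp only [map_add (freeLift a), map_sub (freeLift a), map_smul (freeLift a),
    map_mul (freeLift a), hb, hc, hd, ofLevel_mul]
  rw [← add_assoc, ← add_assoc (wordLevel v), add_comm (wordLevel v) (wordLevel u),
    ← map_smul, ← map_sub, ← map_add]
  convert map_zero (ofLevel (wordLevel u + wordLevel v + wordLevel w) : A →ₗ[ℝ] SuperComm A)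
  rw [koszulSign_add_left, koszulSign_comm (wordLevel u) (wordLevel v + wordLevel w),
    koszulSign_comm (wordLevel v) (wordLevel u + wordLevel w), koszulSign_add_left,
    koszulSign_add_left, koszulSign_comm (wordLevel w) (wordLevel u),
    koszulSign_comm (wordLevel w) (wordLevel v), koszulSign_comm (wordLevel v) (wordLevel u)]
  -- Only the square of the sign of `u` and `v` enters; the other two signs cancel as free
  -- parameters.
  have h := koszulSign_mul_self (wordLevel u) (wordLevel v)
  generalize koszulSign (wordLevel u) (wordLevel v) = s at *
  generalize koszulSign (wordLevel u) (wordLevel w) = t at *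
  generalize koszulSign (wordLevel v) (wordLevel w) = r at *
  simp only [mul_sub, sub_mul, smul_sub, smul_mul_assoc, mul_smul_comm, smul_smul, mul_assoc]
  obtain rfl | rfl := mul_self_eq_one_iff.1 h <;> module

/-- The linear map induced on `U_{n+1}` when all relators are sent to zero. -/
theorem exists_lift (a : Gen n → A) (ha : ∀ x, IsRelator n x → freeLift a x = 0) :
    ∃ Φ : U n →ₗ[ℝ] SuperComm A, (∀ x y, Φ ⁅x, y⁆ = Φ x * Φ y) ∧
      ∀ g, Φ (mk n (gen g)) = ofLevel g.level (a g) := by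
  have hle : relIdeal n ≤ LinearMap.ker (freeLift a : FreeAlg n →ₗ[ℝ] SuperComm A) := by
    refine sInf_le ⟨fun x hx => ha x hx, fun x hx y => ?_⟩
    have hx : freeLift a x = 0 := hx
    constructor
    · show freeLift a (x * y) = 0
      rw [map_mul, hx, zero_mul]
    · show freeLift a (y * x) = 0
      rw [map_mul, hx, mul_zero]
  refine ⟨(relIdeal n).liftQ _ hle, fun x y => ?_, fun g => freeLift_gen a g⟩
  obtain ⟨x, rfl⟩ := (relIdeal n).mkQ_surjective x
  obtain ⟨y, rfl⟩ := (relIdeal n).mkQ_surjective y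
  exact map_mul (freeLift a) x y

end Universal
open SuperComm

/-! ### The quadratic algebra on level `-1` -/

section Quadratic

variable {n : ℕ} {ι : Type*} [Fintype ι]

/-- The coefficients of a linear relation among the brackets of basis elements of level `-1`. -/
def IsQuadRelation (E : Module.Basis ι ℝ (level n (-1))) (c : ι × ι → ℝ) : Prop :=
  ∑ k, c k • ⁅(E k.1 : U n), (E k.2 : U n)⁆ = 0

/-- The relations of the quadratic algebra. -/
inductive QuadRel (E : Module.Basis ι ℝ (level n (-1))) :
    FreeAlgebra ℝ ι → FreeAlgebra ℝ ι → Prop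
  | intro (c : ι × ι → ℝ) (hc : IsQuadRelation E c) :
      QuadRel E (∑ k, c k • (FreeAlgebra.ι ℝ k.1 * FreeAlgebra.ι ℝ k.2 +
        FreeAlgebra.ι ℝ k.2 * FreeAlgebra.ι ℝ k.1)) 0

/-- The associative algebra generated by level `-1` whose anticommutators satisfy the relations
that the brackets of level `-1` satisfy. -/
abbrev QuadAlg (E : Module.Basis ι ℝ (level n (-1))) : Type _ := RingQuot (QuadRel E)

variable {E : Module.Basis ι ℝ (level n (-1))}

/-- The generators of the quadratic algebra. -/
noncomputable def qgen (E : Module.Basis ι ℝ (level n (-1))) (M : ι) : QuadAlg E :=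
  RingQuot.mkAlgHom ℝ (QuadRel E) (FreeAlgebra.ι ℝ M)

theorem qgen_relation {c : ι × ι → ℝ} (hc : IsQuadRelation E c) :
    ∑ k, c k • (qgen E k.1 * qgen E k.2 + qgen E k.2 * qgen E k.1) = 0 := by
  have := RingQuot.mkAlgHom_rel ℝ (QuadRel.intro c hc)
  simpa only [qgen, map_sum, map_smul, map_add, map_mul, map_zero] using this

theorem exists_quadAlg_lift {B : Type*} [Ring B] [Algebra ℝ B] (g : ι → B)
    (hg : ∀ c, IsQuadRelation E c → ∑ k, c k • (g k.1 * g k.2 + g k.2 * g k.1) = 0) :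
    ∃ f : QuadAlg E →ₐ[ℝ] B, ∀ M, f (qgen E M) = g M := by
  refine ⟨RingQuot.liftAlgHom ℝ ⟨FreeAlgebra.lift ℝ g, ?_⟩, fun M => ?_⟩
  · rintro _ _ ⟨c, hc⟩
    simpa only [map_sum, map_smul, map_add, map_mul, map_zero, FreeAlgebra.lift_ι_apply]
      using hg c hc
  · rw [qgen, RingQuot.liftAlgHom_mkAlgHom_apply, FreeAlgebra.lift_ι_apply]

theorem quadAlg_submodule_eq_top (S : Submodule ℝ (QuadAlg E)) (h1 : 1 ∈ S)
    (hS : ∀ M, ∀ w ∈ S, qgen E M * w ∈ S) : S = ⊤ := by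
  have key : ∀ a : FreeAlgebra ℝ ι, ∀ w ∈ S, RingQuot.mkAlgHom ℝ (QuadRel E) a * w ∈ S := by
    intro a
    induction a using FreeAlgebra.induction with
    | grade0 r =>
      intro w hw
      rw [AlgHom.commutes, ← Algebra.smul_def]
      exact S.smul_mem r hw
    | grade1 M => exact hS M
    | mul a b ha hb => intro w hw; rw [map_mul, mul_assoc]; exact ha _ (hb w hw)
    | add a b ha hb => intro w hw; rw [map_add, add_mul]; exact add_mem (ha w hw) (hb w hw)
  refine eq_top_iff.2 fun x _ => ?_
  obtain ⟨a, rfl⟩ := RingQuot.mkAlgHom_surjective ℝ (QuadRel E) x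
  simpa using key a 1 h1

theorem quadAlg_hom_ext {Y : Type*} [AddCommGroup Y] [Module ℝ Y] {φ ψ : QuadAlg E →ₗ[ℝ] Y}
    (h1 : φ 1 = ψ 1) (h : ∀ M w, φ w = ψ w → φ (qgen E M * w) = ψ (qgen E M * w)) : φ = ψ := by
  have := quadAlg_submodule_eq_top (LinearMap.eqLocus φ ψ) h1 h
  exact LinearMap.eqLocus_eq_top.1 this

/-- Recursive definition of linear maps on the quadratic algebra. -/
theorem exists_quadAlg_rec {Y : Type*} [AddCommGroup Y] [Module ℝ Y]
    (g : ι → QuadAlg E × Y →ₗ[ℝ] Y) (y : Y)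
    (hg : ∀ c, IsQuadRelation E c → ∀ w z, ∑ k, c k • (g k.1 (qgen E k.2 * w, g k.2 (w, z)) +
      g k.2 (qgen E k.1 * w, g k.1 (w, z))) = 0) :
    ∃ φ : QuadAlg E →ₗ[ℝ] Y, φ 1 = y ∧ ∀ M w, φ (qgen E M * w) = g M (w, φ w) := by
  -- The recursion is run on pairs: the first component records the element itself, the second the
  -- value so far. `hg` is the quadratic relation in the second component.
  obtain ⟨f, hf⟩ := exists_quadAlg_lift (E := E) (B := Module.End ℝ (QuadAlg E × Y))
    (fun M => LinearMap.prod (LinearMap.mulLeft ℝ (qgen E M) ∘ₗ LinearMap.fst ℝ _ _) (g M)) (by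
      intro c hc
      refine LinearMap.ext fun ⟨w, z⟩ => Prod.ext ?_ ?_
      · simpa [Prod.fst_sum, Finset.sum_mul, add_mul, mul_assoc] using
          congrArg (· * w) (qgen_relation hc)
      · simpa [Prod.snd_sum] using hg c hc w z)
  have hfst : ∀ w p, (f w p).1 = w * p.1 := by
    intro w p
    have : (LinearMap.fst ℝ _ _ ∘ₗ (LinearMap.applyₗ p) ∘ₗ f.toLinearMap) =
        LinearMap.mulRight ℝ p.1 := by
      refine quadAlg_hom_ext (by simp) fun M w hw => ?_
      simp only [LinearMap.comp_apply, AlgHom.toLinearMap_apply, map_mul, hf,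
        LinearMap.mulRight_apply] at hw ⊢
      rw [mul_assoc, ← hw]
      rfl
    exact LinearMap.congr_fun this w
  refine ⟨LinearMap.snd ℝ _ _ ∘ₗ (LinearMap.applyₗ ((1 : QuadAlg E), y)) ∘ₗ f.toLinearMap,
    by simp, fun M w => ?_⟩
  have h := hfst w (1, y)
  rw [mul_one] at h
  simp only [LinearMap.comp_apply, AlgHom.toLinearMap_apply, map_mul, hf, LinearMap.snd_apply]
  exact congrArg (g M) (Prod.ext h rfl)

theorem exists_qlin (E : Module.Basis ι ℝ (level n (-1))) :
    ∃ ε : U n →ₗ[ℝ] QuadAlg E, ∀ M, ε (E M) = qgen E M := by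
  obtain ⟨ε, hε⟩ := LinearMap.exists_extend (E.constr ℝ (qgen E))
  exact ⟨ε, fun M => (LinearMap.congr_fun hε (E M)).trans (E.constr_basis ℝ _ M)⟩

/-- A linear extension to `U_{n+1}` of the inclusion of level `-1` in the quadratic algebra. -/
noncomputable def qlin (E : Module.Basis ι ℝ (level n (-1))) : U n →ₗ[ℝ] QuadAlg E :=
  (exists_qlin E).choose

@[simp] theorem qlin_basis (M : ι) : qlin E (E M) = qgen E M := (exists_qlin E).choose_spec M

theorem level_neg_one_induction {κ : Type*} {E : Module.Basis κ ℝ (level n (-1))}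
    {p : (x : U n) → x ∈ level n (-1) → Prop}
    (hE : ∀ M, p (E M) (E M).2) (h0 : p 0 (zero_mem _))
    (hadd : ∀ x y hx hy, p x hx → p y hy → p (x + y) (add_mem hx hy))
    (hsmul : ∀ (c : ℝ) x hx, p x hx → p (c • x) (Submodule.smul_mem _ c hx)) {x : U n}
    (hx : x ∈ level n (-1)) : p x hx := by
  have H : ∀ y, ∀ hy : y ∈ Submodule.span ℝ (Set.range fun i => (E i : U n)),
      p y ((span_range_basis E).ge hy) := by
    intro y hy
    induction hy using Submodule.span_induction with
    | mem x h => obtain ⟨M, rfl⟩ := h; exact hE M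
    | zero => exact h0
    | add x y hx hy h h' => exact hadd x y _ _ h h'
    | smul c x _ hx => exact hsmul c x _ hx
  exact H x ((span_range_basis E).le hx)

/-- The quadratic algebra imposes on anticommutators every linear relation that the brackets of
basis elements satisfy, so a bracket determines the anticommutator. -/
theorem exists_anticomm (E : Module.Basis ι ℝ (level n (-1))) :
    ∃ μ : U n →ₗ[ℝ] QuadAlg E, ∀ x ∈ level n (-1), ∀ y ∈ level n (-1),
      μ ⁅x, y⁆ = qlin E x * qlin E y + qlin E y * qlin E x := by
  obtain ⟨μ, hμ⟩ := exists_comp_eq_of_ker_le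
    (Fintype.linearCombination ℝ fun k : ι × ι => ⁅(E k.1 : U n), (E k.2 : U n)⁆)
    (Fintype.linearCombination ℝ fun k : ι × ι =>
      qgen E k.1 * qgen E k.2 + qgen E k.2 * qgen E k.1) (fun c hc => qgen_relation hc)
  have hμ' : ∀ M N, μ ⁅(E M : U n), (E N : U n)⁆ =
      qgen E M * qgen E N + qgen E N * qgen E M := by
    classical
    intro M N
    have := hμ (Pi.single (M, N) 1)
    rwa [Fintype.linearCombination_apply_single, Fintype.linearCombination_apply_single,
      one_smul, one_smul] at this
  refine ⟨μ, fun x hx y hy => ?_⟩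
  induction hx using level_neg_one_induction (E := E) with
  | h0 => simp
  | hadd a b _ _ ha hb => simp only [add_bracket, map_add, ha, hb, add_mul, mul_add]; abel
  | hsmul c a _ ha => simp only [smul_bracket, map_smul, ha, smul_mul_assoc, mul_smul_comm, smul_add]
  | hE M =>
    induction hy using level_neg_one_induction (E := E) with
    | h0 => simp
    | hadd a b _ _ ha hb => simp only [bracket_add, map_add, ha, hb, add_mul, mul_add]; abel
    | hsmul c a _ ha =>
      simp only [bracket_smul, map_smul, ha, smul_mul_assoc, mul_smul_comm, smul_add]
    | hE N => simp [hμ']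

theorem basis_mem_level {κ : Type*} {E : Module.Basis κ ℝ (level n (-1))} (M : κ) :
    (E M : U n) ∈ level n (-1) := (E M).2

theorem bracket_level_zero_mem {p : ℤ} {s x : U n} (hs : s ∈ level n 0) (hx : x ∈ level n p) :
    ⁅s, x⁆ ∈ level n p := by
  simpa using bracket_mem_level hs hx

/-- The level -2 relations are stable under level 0: apply ad s to a vanishing combination and
transport the result by `exists_anticomm`. This makes the derivations of the quadratic algebra well
defined. -/
theorem qlin_derivation_relation {c : ι × ι → ℝ} (hc : IsQuadRelation E c) {s : U n}
    (hs : s ∈ level n 0) :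
    ∑ k, c k • ((qlin E ⁅s, (E k.1 : U n)⁆ * qgen E k.2 + qgen E k.2 * qlin E ⁅s, (E k.1 : U n)⁆) +
      (qgen E k.1 * qlin E ⁅s, (E k.2 : U n)⁆ + qlin E ⁅s, (E k.2 : U n)⁆ * qgen E k.1)) = 0 := by
  obtain ⟨μ, hμ⟩ := exists_anticomm E
  have h : ⁅s, ∑ k, c k • ⁅(E k.1 : U n), (E k.2 : U n)⁆⁆ = 0 := by
    rw [show ∑ k, c k • ⁅(E k.1 : U n), (E k.2 : U n)⁆ = 0 from hc, bracket_zero]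
  have := congrArg μ h
  simp only [bracket_sum, bracket_smul, map_sum, map_smul, map_zero] at this
  rw [← this]
  refine Finset.sum_congr rfl fun k _ => ?_
  rw [bracket_jacobi_zero hs (basis_mem_level _), map_add,
    hμ _ (bracket_level_zero_mem hs (basis_mem_level _)) _ (basis_mem_level _),
    hμ _ (basis_mem_level _) _ (bracket_level_zero_mem hs (basis_mem_level _))]
  simp

/-! ### The action of the local part on the quadratic algebra -/

theorem exists_qder (E : Module.Basis ι ℝ (level n (-1))) (s : level n 0) :
    ∃ δ : QuadAlg E →ₗ[ℝ] QuadAlg E, δ 1 = 0 ∧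
      ∀ M w, δ (qgen E M * w) = qlin E ⁅(s : U n), (E M : U n)⁆ * w + qgen E M * δ w := by
  refine exists_quadAlg_rec (fun M => LinearMap.mulLeft ℝ (qlin E ⁅(s : U n), (E M : U n)⁆) ∘ₗ
    LinearMap.fst ℝ _ _ + LinearMap.mulLeft ℝ (qgen E M) ∘ₗ LinearMap.snd ℝ _ _) 0 ?_
  intro c hc w z
  have h1 := congrArg (· * w) (qlin_derivation_relation hc s.2)
  have h2 := congrArg (· * z) (qgen_relation hc)
  simp only [zero_mul, Finset.sum_mul] at h1 h2
  have h := congrArg₂ (· + ·) h1 h2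
  simp only [← Finset.sum_add_distrib, add_zero] at h
  rw [← h]
  refine Finset.sum_congr rfl fun k _ => ?_
  simp only [smul_mul_assoc, ← smul_add]
  congr 1
  simp only [LinearMap.add_apply, LinearMap.comp_apply, LinearMap.fst_apply, LinearMap.snd_apply,
    LinearMap.mulLeft_apply]
  noncomm_ring

/-- The derivation of the quadratic algebra given by an element of level `0`. -/
noncomputable def qder (E : Module.Basis ι ℝ (level n (-1))) :
    level n 0 →ₗ[ℝ] Module.End ℝ (QuadAlg E) where
  toFun s := (exists_qder E s).choose
  map_add' s t := by
    refine quadAlg_hom_ext ?_ fun M w hw => ?_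
    · change (exists_qder E _).choose 1 = (exists_qder E _).choose 1 + (exists_qder E _).choose 1
      simp only [(exists_qder E _).choose_spec.1, add_zero]
    · simp only [LinearMap.add_apply, (exists_qder E _).choose_spec.2] at hw ⊢
      rw [hw]
      simp [add_mul, mul_add]
      abel
  map_smul' c s := by
    refine quadAlg_hom_ext ?_ fun M w hw => ?_
    · change (exists_qder E _).choose 1 = c • (exists_qder E _).choose 1
      simp only [(exists_qder E _).choose_spec.1, smul_zero]
    · simp only [LinearMap.smul_apply, (exists_qder E _).choose_spec.2] at hw ⊢
      rw [hw]
      simp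

@[simp] theorem qder_one (s : level n 0) : qder E s 1 = 0 := (exists_qder E s).choose_spec.1

theorem qder_qgen_mul (s : level n 0) (M : ι) (w : QuadAlg E) :
    qder E s (qgen E M * w) = qlin E ⁅(s : U n), (E M : U n)⁆ * w + qgen E M * qder E s w :=
  (exists_qder E s).choose_spec.2 M w

theorem qder_qlin_mul (s : level n 0) {x : U n} (hx : x ∈ level n (-1)) (w : QuadAlg E) :
    qder E s (qlin E x * w) = qlin E ⁅(s : U n), x⁆ * w + qlin E x * qder E s w := by
  induction hx using level_neg_one_induction (E := E) with
  | h0 => simp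
  | hadd a b _ _ ha hb => simp only [bracket_add, map_add, ha, hb, add_mul]; abel
  | hsmul c a _ ha => simp only [bracket_smul, map_smul, ha, smul_mul_assoc, smul_add]
  | hE M => simp [qder_qgen_mul]

theorem qder_bracket (s t : level n 0) (w : QuadAlg E) :
    qder E ⟨⁅(s : U n), (t : U n)⁆, bracket_level_zero_mem s.2 t.2⟩ w =
      qder E s (qder E t w) - qder E t (qder E s w) := by
  have : qder E ⟨⁅(s : U n), (t : U n)⁆, bracket_level_zero_mem s.2 t.2⟩ =
      qder E s * qder E t - qder E t * qder E s := by
    refine quadAlg_hom_ext (by simp) fun M w hw => ?_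
    simp only [LinearMap.sub_apply, Module.End.mul_apply] at hw ⊢
    simp only [qder_qgen_mul, map_add, qder_qlin_mul _ (bracket_level_zero_mem t.2
      (basis_mem_level (E := E) M)), qder_qlin_mul _ (bracket_level_zero_mem s.2
      (basis_mem_level (E := E) M)), hw]
    rw [bracket_jacobi_zero s.2 t.2, map_add, add_mul, mul_sub]
    abel
  rw [this]; rfl

theorem bracket_one_neg_one_mem {x y : U n} (hx : x ∈ level n 1) (hy : y ∈ level n (-1)) :
    ⁅x, y⁆ ∈ level n 0 := by
  simpa using bracket_mem_level hx hy

/-- The element `[x, E_M]` of level `0` for `x` of level `1`. -/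
noncomputable def lowerBy (E : Module.Basis ι ℝ (level n (-1))) (M : ι) :
    level n 1 →ₗ[ℝ] level n 0 where
  toFun x := ⟨⁅(x : U n), (E M : U n)⁆, bracket_one_neg_one_mem x.2 (E M).2⟩
  map_add' x y := Subtype.ext (by simp)
  map_smul' c x := Subtype.ext (by simp)

/-- Apply ad x to a vanishing combination at level -2. This is the consistency condition for the
operators of level 1. -/
theorem qlin_contraction_relation {c : ι × ι → ℝ} (hc : IsQuadRelation E c) {x : U n}
    (hx : x ∈ level n 1) :
    ∑ k, c k • (qlin E ⁅⁅x, (E k.1 : U n)⁆, (E k.2 : U n)⁆ +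
      qlin E ⁅⁅x, (E k.2 : U n)⁆, (E k.1 : U n)⁆) = 0 := by
  have h : ⁅x, ∑ k, c k • ⁅(E k.1 : U n), (E k.2 : U n)⁆⁆ = 0 := by
    rw [show ∑ k, c k • ⁅(E k.1 : U n), (E k.2 : U n)⁆ = 0 from hc, bracket_zero]
  have := congrArg (qlin E) h
  simp only [bracket_sum, bracket_smul, map_sum, map_smul, map_zero] at this
  rw [← this]
  refine Finset.sum_congr rfl fun k _ => ?_
  rw [bracket_jacobi' hx (basis_mem_level _), koszulSign_of_odd (by decide) (by decide),
    bracket_skew_zero (bracket_one_neg_one_mem hx (basis_mem_level k.2)) (basis_mem_level k.1)]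
  simp

/-- The recursion prescribes that the anticommutator of the operator with left multiplication by a
generator is the derivation of [x, E_M]. In the consistency check the products of a generator and a
derivation cancel in pairs, leaving the contraction relation times `w` and the quadratic relation
times `z`. -/
theorem exists_qcon (E : Module.Basis ι ℝ (level n (-1))) (x : level n 1) :
    ∃ δ : QuadAlg E →ₗ[ℝ] QuadAlg E, δ 1 = 0 ∧
      ∀ M w, δ (qgen E M * w) = qder E (lowerBy E M x) w - qgen E M * δ w := by
  refine exists_quadAlg_rec (fun M => qder E (lowerBy E M x) ∘ₗ
    LinearMap.fst ℝ _ _ - LinearMap.mulLeft ℝ (qgen E M) ∘ₗ LinearMap.snd ℝ _ _) 0 ?_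
  intro c hc w z
  have h1 := congrArg (· * w) (qlin_contraction_relation hc x.2)
  have h2 := congrArg (· * z) (qgen_relation hc)
  simp only [zero_mul, Finset.sum_mul] at h1 h2
  have h := congrArg₂ (· + ·) h1 h2
  simp only [← Finset.sum_add_distrib, add_zero] at h
  rw [← h]
  refine Finset.sum_congr rfl fun k _ => ?_
  simp only [smul_mul_assoc, ← smul_add]
  congr 1
  simp only [LinearMap.sub_apply, LinearMap.comp_apply, LinearMap.fst_apply, LinearMap.snd_apply,
    LinearMap.mulLeft_apply, qder_qgen_mul, lowerBy, LinearMap.coe_mk, AddHom.coe_mk, mul_sub, add_mul, mul_assoc]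
  abel

/-- The operator on the quadratic algebra given by an element of level `1`. -/
noncomputable def qcon (E : Module.Basis ι ℝ (level n (-1))) :
    level n 1 →ₗ[ℝ] Module.End ℝ (QuadAlg E) where
  toFun x := (exists_qcon E x).choose
  map_add' s t := by
    refine quadAlg_hom_ext ?_ fun M w hw => ?_
    · change (exists_qcon E _).choose 1 = (exists_qcon E _).choose 1 + (exists_qcon E _).choose 1
      simp only [(exists_qcon E _).choose_spec.1, add_zero]
    · simp only [LinearMap.add_apply, (exists_qcon E _).choose_spec.2] at hw ⊢
      rw [hw]
      simp [mul_add]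
      abel
  map_smul' c s := by
    refine quadAlg_hom_ext ?_ fun M w hw => ?_
    · change (exists_qcon E _).choose 1 = c • (exists_qcon E _).choose 1
      simp only [(exists_qcon E _).choose_spec.1, smul_zero]
    · simp only [LinearMap.smul_apply, (exists_qcon E _).choose_spec.2] at hw ⊢
      rw [hw]
      simp [smul_sub]

@[simp] theorem qcon_one (x : level n 1) : qcon E x 1 = 0 := (exists_qcon E x).choose_spec.1

theorem qcon_qgen_mul (x : level n 1) (M : ι) (w : QuadAlg E) :
    qcon E x (qgen E M * w) = qder E (lowerBy E M x) w - qgen E M * qcon E x w :=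
  (exists_qcon E x).choose_spec.2 M w

theorem qcon_qlin_mul (x : level n 1) (y : level n (-1)) (w : QuadAlg E) :
    qcon E x (qlin E y * w) =
      qder E ⟨⁅(x : U n), (y : U n)⁆, bracket_one_neg_one_mem x.2 y.2⟩ w -
        qlin E y * qcon E x w := by
  let L : level n (-1) →ₗ[ℝ] level n 0 :=
    { toFun := fun y => ⟨⁅(x : U n), (y : U n)⁆, bracket_one_neg_one_mem x.2 y.2⟩
      map_add' := fun x y => Subtype.ext (by simp)
      map_smul' := fun c x => Subtype.ext (by simp) }
  show _ = qder E (L y) w - _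
  have : (qcon E x ∘ₗ LinearMap.mulRight ℝ w ∘ₗ qlin E ∘ₗ (level n (-1)).subtype) =
      LinearMap.applyₗ w ∘ₗ qder E ∘ₗ L -
        LinearMap.mulRight ℝ (qcon E x w) ∘ₗ qlin E ∘ₗ (level n (-1)).subtype := by
    refine E.ext fun M => ?_
    simp only [LinearMap.comp_apply, LinearMap.sub_apply, Submodule.subtype_apply, qlin_basis,
      LinearMap.mulRight_apply, qcon_qgen_mul]
    rfl
  exact LinearMap.congr_fun this y

theorem qder_qcon (s : level n 0) (x : level n 1) (w : QuadAlg E) :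
    qcon E ⟨⁅(s : U n), (x : U n)⁆, bracket_level_zero_mem s.2 x.2⟩ w =
      qder E s (qcon E x w) - qcon E x (qder E s w) := by
  have : qcon E ⟨⁅(s : U n), (x : U n)⁆, bracket_level_zero_mem s.2 x.2⟩ =
      qder E s * qcon E x - qcon E x * qder E s := by
    refine quadAlg_hom_ext (by simp) fun M w hw => ?_
    simp only [LinearMap.sub_apply, Module.End.mul_apply] at hw ⊢
    have h1 := qcon_qlin_mul (E := E) x
      ⟨⁅(s : U n), (E M : U n)⁆, bracket_level_zero_mem s.2 (E M).2⟩ w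
    have h2 := qder_bracket (E := E) s (lowerBy E M x) w
    simp only at h1
    simp only [qder_qgen_mul, qcon_qgen_mul, map_add, map_sub, h1, hw]
    have h3 : lowerBy E M ⟨⁅(s : U n), (x : U n)⁆, bracket_level_zero_mem s.2 x.2⟩ =
      ⟨⁅(s : U n), (lowerBy E M x : U n)⁆, bracket_level_zero_mem s.2 (lowerBy E M x).2⟩ -
      ⟨⁅(x : U n), ⁅(s : U n), (E M : U n)⁆⁆,
        bracket_one_neg_one_mem x.2 (bracket_level_zero_mem s.2 (E M).2)⟩ := by
      refine Subtype.ext ?_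
      simp only [lowerBy, LinearMap.coe_mk, AddHom.coe_mk, AddSubgroupClass.coe_sub]
      rw [bracket_jacobi s.2 x.2]
      simp
    rw [h3, map_sub, LinearMap.sub_apply, h2, mul_sub]
    abel
  rw [this]; rfl

/-- Passing the square of the operator through a generator leaves the operator of [[x, E_M], x].
This element vanishes because 0 = [[x, x], E_M] = 2[x, [x, E_M]]. -/
theorem qcon_qcon {x : level n 1} (hx : ⁅(x : U n), (x : U n)⁆ = 0) (w : QuadAlg E) :
    qcon E x (qcon E x w) = 0 := by
  have : qcon E x * qcon E x = 0 := by
    refine quadAlg_hom_ext (by simp) fun M w hw => ?_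
    simp only [LinearMap.zero_apply, Module.End.mul_apply] at hw ⊢
    have h2 := qder_qcon (E := E) (lowerBy E M x) x w
    have h3 : (⟨⁅(lowerBy E M x : U n), (x : U n)⁆,
        bracket_level_zero_mem (lowerBy E M x).2 x.2⟩ : level n 1) = 0 := by
      refine Subtype.ext ?_
      simp only [lowerBy, LinearMap.coe_mk, AddHom.coe_mk, ZeroMemClass.coe_zero]
      have h4 := bracket_jacobi x.2 x.2 (E M : U n)
      rw [hx, koszulSign_of_odd (by decide) (by decide), zero_bracket, neg_smul, one_smul,
        sub_neg_eq_add, ← two_smul ℝ, eq_comm, smul_eq_zero_iff_right two_ne_zero] at h4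
      rw [bracket_skew_zero (bracket_one_neg_one_mem x.2 (E M).2) x.2, h4, neg_zero]
    rw [h3, map_zero, LinearMap.zero_apply] at h2
    rw [qcon_qgen_mul, map_sub, qcon_qgen_mul, hw, mul_zero, sub_zero, ← neg_sub, ← h2, neg_zero]
  exact LinearMap.congr_fun this w

end Quadratic
open SuperComm

/-! ### Extension of the local action to a representation of U_{n+1} -/

section Representation

variable {n : ℕ} {ι : Type*} [Fintype ι] {E : Module.Basis ι ℝ (level n (-1))}

/-- The operator on the quadratic algebra given by an element of the local part. -/
noncomputable def localOp (E : Module.Basis ι ℝ (level n (-1))) (p : ℤ) :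
    level n p →ₗ[ℝ] Module.End ℝ (QuadAlg E) :=
  if h : p = 0 then h ▸ qder E else if h : p = 1 then h ▸ qcon E
  -- Meaningful only for p = -1; at the remaining levels this is a default value.
  else LinearMap.mul ℝ (QuadAlg E) ∘ₗ qlin E ∘ₗ (level n p).subtype

@[simp] theorem localOp_zero : localOp E 0 = qder E := by simp [localOp]

@[simp] theorem localOp_one : localOp E 1 = qcon E := by simp [localOp]

@[simp] theorem localOp_neg_one_apply (x : level n (-1)) (w : QuadAlg E) :
    localOp E (-1) x w = qlin E x * w := by
  rw [localOp, dif_neg (by decide), dif_neg (by decide)]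
  rfl

/-- The bracket and the super commutator have the same skew-symmetry, so each pair of levels needs
checking in one order only. -/
theorem localOp_mul_swap {p q r : ℤ} (hr : p + q = r) (x : level n p) (y : level n q)
    (hxy : ⁅(x : U n), (y : U n)⁆ ∈ level n r) (hyx : ⁅(y : U n), (x : U n)⁆ ∈ level n r)
    (h : ofLevel p (localOp E p x) * ofLevel q (localOp E q y) =
      ofLevel r (localOp E r ⟨_, hxy⟩)) :
    ofLevel q (localOp E q y) * ofLevel p (localOp E p x) =
      ofLevel r (localOp E r ⟨_, hyx⟩) := by
  have e : (⟨_, hyx⟩ : level n r) = -(koszulSign q p • ⟨_, hxy⟩) :=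
    Subtype.ext (bracket_skew y.2 x.2)
  subst hr
  rw [e, map_neg, map_smul, map_neg, map_smul, ← h, ofLevel_mul, ofLevel_mul, add_comm q p,
    koszulSign_comm p q, ← map_smul, ← map_neg]
  congr 1
  rw [smul_sub, smul_smul, koszulSign_mul_self]
  module

theorem ofLevel_localOp_mul {p q r : ℤ} (h : LocalPair p q) (hr : p + q = r) (x : level n p)
    (y : level n q) (hxy : ⁅(x : U n), (y : U n)⁆ ∈ level n r) :
    ofLevel p (localOp E p x) * ofLevel q (localOp E q y) =
      ofLevel r (localOp E r ⟨_, hxy⟩) := by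
  obtain ⟨hp, hq, hpq⟩ := h
  have h00 : ∀ (x y : level n 0) (hxy : ⁅(x : U n), (y : U n)⁆ ∈ level n 0),
      ofLevel 0 (localOp E 0 x) * ofLevel 0 (localOp E 0 y) =
        ofLevel 0 (localOp E 0 ⟨_, hxy⟩) := by
    intro x y hxy
    rw [ofLevel_mul]
    congr 1
    refine LinearMap.ext fun w => ?_
    simp only [localOp_zero, koszulSign_zero_left, one_smul]
    exact (qder_bracket x y w).symm
  have h01 : ∀ (x : level n 0) (y : level n 1) (hxy : ⁅(x : U n), (y : U n)⁆ ∈ level n 1),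
      ofLevel 0 (localOp E 0 x) * ofLevel 1 (localOp E 1 y) =
        ofLevel 1 (localOp E 1 ⟨_, hxy⟩) := by
    intro x y hxy
    rw [ofLevel_mul]
    congr 1
    refine LinearMap.ext fun w => ?_
    simp only [koszulSign_zero_left, one_smul, localOp_zero, localOp_one]
    exact (qder_qcon x y w).symm
  have h0m : ∀ (x : level n 0) (y : level n (-1)) (hxy : ⁅(x : U n), (y : U n)⁆ ∈ level n (-1)),
      ofLevel 0 (localOp E 0 x) * ofLevel (-1) (localOp E (-1) y) =
        ofLevel (-1) (localOp E (-1) ⟨_, hxy⟩) := by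
    intro x y hxy
    rw [ofLevel_mul]
    congr 1
    refine LinearMap.ext fun w => ?_
    rw [koszulSign_zero_left, one_smul, localOp_zero, LinearMap.sub_apply, Module.End.mul_apply,
      Module.End.mul_apply, localOp_neg_one_apply, localOp_neg_one_apply, localOp_neg_one_apply,
      qder_qlin_mul x y.2, add_sub_cancel_right]
  have h1m : ∀ (x : level n 1) (y : level n (-1)) (hxy : ⁅(x : U n), (y : U n)⁆ ∈ level n 0),
      ofLevel 1 (localOp E 1 x) * ofLevel (-1) (localOp E (-1) y) =
        ofLevel 0 (localOp E 0 ⟨_, hxy⟩) := by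
    intro x y hxy
    rw [ofLevel_mul_of_odd (by decide) (by decide)]
    congr 1
    refine LinearMap.ext fun w => ?_
    rw [localOp_zero, localOp_one, LinearMap.add_apply, Module.End.mul_apply,
      Module.End.mul_apply, localOp_neg_one_apply, localOp_neg_one_apply, qcon_qlin_mul,
      sub_add_cancel]
  obtain ⟨hp1, hp2⟩ := abs_le.1 hp
  obtain ⟨hq1, hq2⟩ := abs_le.1 hq
  obtain ⟨hpq1, hpq2⟩ := abs_le.1 hpq
  have hp' : p = -1 ∨ p = 0 ∨ p = 1 := by omega
  have hq' : q = -1 ∨ q = 0 ∨ q = 1 := by omega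
  have hyx : ⁅(y : U n), (x : U n)⁆ ∈ level n r := by
    have := bracket_mem_level y.2 x.2
    rwa [add_comm, hr] at this
  rcases hp' with rfl | rfl | rfl <;> rcases hq' with rfl | rfl | rfl
  · omega
  · obtain rfl : r = -1 := by omega
    exact localOp_mul_swap (by norm_num) _ _ hyx hxy (h0m y x hyx)
  · obtain rfl : r = 0 := by omega
    exact localOp_mul_swap (by norm_num) _ _ hyx hxy (h1m y x hyx)
  · obtain rfl : r = -1 := by omega
    exact h0m x y hxy
  · obtain rfl : r = 0 := by omega
    exact h00 x y hxy
  · obtain rfl : r = 1 := by omega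
    exact h01 x y hxy
  · obtain rfl : r = 0 := by omega
    exact h1m x y hxy
  · obtain rfl : r = 1 := by omega
    exact localOp_mul_swap (by norm_num) _ _ hyx hxy (h01 y x hyx)
  · omega

theorem gen_mem_level (g : Gen n) : mk n (gen g) ∈ level n g.level := mk_word_mem (.of g)

/-- The operators given by the Chevalley generators. -/
noncomputable def genOp (E : Module.Basis ι ℝ (level n (-1))) (g : Gen n) :
    Module.End ℝ (QuadAlg E) := localOp E g.level ⟨mk n (gen g), gen_mem_level g⟩

/-- An element `x` of the free algebra is sent to the operator of its image in the local part. -/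
def IsCompatible (E : Module.Basis ι ℝ (level n (-1))) (p : ℤ) (x : FreeAlg n) : Prop :=
  ∃ hx : mk n x ∈ level n p, freeLift (genOp E) x = ofLevel p (localOp E p ⟨mk n x, hx⟩)

theorem isCompatible_gen (g : Gen n) : IsCompatible E g.level (gen g) :=
  ⟨gen_mem_level g, freeLift_gen _ g⟩

theorem IsCompatible.mul {p q r : ℤ} {x y : FreeAlg n} (hx : IsCompatible E p x)
    (hy : IsCompatible E q y) (h : LocalPair p q) (hr : p + q = r) : IsCompatible E r (x * y) := by
  obtain ⟨hx, hx'⟩ := hx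
  obtain ⟨hy, hy'⟩ := hy
  have hxy : ⁅mk n x, mk n y⁆ ∈ level n r := hr ▸ bracket_mem_level hx hy
  exact ⟨hxy, by rw [map_mul, hx', hy', ofLevel_localOp_mul h hr _ _ hxy]; rfl⟩

theorem IsCompatible.add {p : ℤ} {x y : FreeAlg n} (hx : IsCompatible E p x)
    (hy : IsCompatible E p y) : IsCompatible E p (x + y) := by
  obtain ⟨hx, hx'⟩ := hx
  obtain ⟨hy, hy'⟩ := hy
  refine ⟨by rw [map_add]; exact add_mem hx hy, ?_⟩
  rw [map_add, hx', hy', ← map_add, ← map_add]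
  congr! 2

theorem IsCompatible.smul {p : ℤ} {x : FreeAlg n} (c : ℝ) (hx : IsCompatible E p x) :
    IsCompatible E p (c • x) := by
  obtain ⟨hx, hx'⟩ := hx
  refine ⟨by rw [map_smul]; exact Submodule.smul_mem _ c hx, ?_⟩
  rw [map_smul, hx', ← map_smul, ← map_smul]
  congr! 2

theorem IsCompatible.zero (p : ℤ) : IsCompatible E p 0 := by
  refine ⟨by rw [map_zero]; exact zero_mem _, ?_⟩
  rw [map_zero, ← map_zero (ofLevel p), ← map_zero (localOp E p)]
  congr! 2

theorem IsCompatible.sub {p : ℤ} {x y : FreeAlg n} (hx : IsCompatible E p x)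
    (hy : IsCompatible E p y) : IsCompatible E p (x - y) := by
  have := hx.add (hy.smul (-1))
  rwa [neg_one_smul, ← sub_eq_add_neg] at this

theorem IsCompatible.eq_zero {p : ℤ} {x : FreeAlg n} (hx : IsCompatible E p x)
    (h : mk n x = 0) : freeLift (genOp E) x = 0 := by
  obtain ⟨hx, hx'⟩ := hx
  rw [hx', show (⟨mk n x, hx⟩ : level n p) = 0 from Subtype.ext h, map_zero, map_zero]

theorem level_e (i : Fin (n + 1)) :
    i = 0 ∧ (Gen.e i : Gen n).level = -1 ∨ i ≠ 0 ∧ (Gen.e i : Gen n).level = 0 := by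
  by_cases h : i = 0 <;> simp [Gen.level, h]

theorem level_f (i : Fin (n + 1)) :
    i = 0 ∧ (Gen.f i : Gen n).level = 1 ∨ i ≠ 0 ∧ (Gen.f i : Gen n).level = 0 := by
  by_cases h : i = 0 <;> simp [Gen.level, h]

theorem localPair_zero_left {p : ℤ} (hp : |p| ≤ 1) : LocalPair 0 p :=
  ⟨by simp, hp, by simpa using hp⟩

theorem Gen.abs_level_le (g : Gen n) : |g.level| ≤ 1 := by
  rcases g.level_cases with h | h | h <;> simp [h]

theorem IsCompatible.iterate {p : ℤ} (hp : |p| ≤ 1) {x y : FreeAlg n} (hx : IsCompatible E 0 x)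
    (hy : IsCompatible E p y) : ∀ m : ℕ, IsCompatible E p ((fun z => x * z)^[m] y)
  | 0 => hy
  | m + 1 => by
    rw [Function.iterate_succ_apply']
    exact hx.mul (hx.iterate hp hy m) (localPair_zero_left hp) (zero_add p)

/-- Skew-symmetry and Jacobi hold for any super commutator. The Chevalley relations and the Serre
relations with i ≥ 1 never leave the local part, where operators respect brackets, so each goes to
the operator of a zero element. Only the squares of e₀ and f₀, at levels -2 and 2, need an argument:
the first is one of the quadratic relations, the second is `qcon_qcon`. -/
theorem freeLift_genOp_eq_zero {x : FreeAlg n} (hx : IsRelator n x) :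
    freeLift (genOp E) x = 0 := by
  have h0 := mk_eq_zero_of_isRelator hx
  have comp : ∀ g : Gen n, ∀ p, g.level = p → IsCompatible E p (gen g) := by
    rintro g _ rfl; exact isCompatible_gen g
  cases hx with
  | skew u v => exact freeLift_skew _ u v
  | jacobi u v w => exact freeLift_jacobi _ u v w
  | h_e i j =>
    exact (((comp (.h i) 0 rfl).mul (isCompatible_gen (.e j))
      (localPair_zero_left (Gen.abs_level_le _)) (zero_add _)).sub
      ((isCompatible_gen (.e j)).smul _)).eq_zero h0
  | h_f i j =>
    exact (((comp (.h i) 0 rfl).mul (isCompatible_gen (.f j))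
      (localPair_zero_left (Gen.abs_level_le _)) (zero_add _)).add
      ((isCompatible_gen (.f j)).smul _)).eq_zero h0
  | h_h i j =>
    exact ((comp (.h i) 0 rfl).mul (comp (.h j) 0 rfl)
      (localPair_zero_left (by simp)) (zero_add _)).eq_zero h0
  | serre_e i j hi hij =>
    exact (IsCompatible.iterate (Gen.abs_level_le (.e j)) (comp (.e i) 0 (if_neg hi))
      (isCompatible_gen (.e j)) _).eq_zero h0
  | serre_f i j hi hij =>
    exact (IsCompatible.iterate (Gen.abs_level_le (.f j)) (comp (.f i) 0 (if_neg hi))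
      (isCompatible_gen (.f j)) _).eq_zero h0
  | serre_e_zero =>
    obtain ⟨h, h'⟩ := comp (.e 0) (-1) rfl
    obtain ⟨μ, hμ⟩ := exists_anticomm E
    have h1 := hμ _ h _ h
    rw [show ⁅mk n (gen (.e 0)), mk n (gen (.e 0))⁆ = 0 from h0, map_zero] at h1
    have H : localOp E (-1) ⟨_, h⟩ * localOp E (-1) ⟨_, h⟩ +
        localOp E (-1) ⟨_, h⟩ * localOp E (-1) ⟨_, h⟩ = 0 := by
      refine LinearMap.ext fun w => ?_
      rw [LinearMap.add_apply, Module.End.mul_apply, localOp_neg_one_apply,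
        localOp_neg_one_apply, ← mul_assoc, ← add_mul, ← h1, zero_mul, LinearMap.zero_apply]
    rw [map_mul, h', ofLevel_mul_of_odd (by decide) (by decide), H, map_zero]
  | serre_f_zero =>
    obtain ⟨h, h'⟩ := comp (.f 0) 1 rfl
    have H : localOp E 1 ⟨_, h⟩ * localOp E 1 ⟨_, h⟩ = 0 := by
      refine LinearMap.ext fun w => ?_
      rw [Module.End.mul_apply, localOp_one]
      exact qcon_qcon (x := ⟨_, h⟩) h0 w
    rw [map_mul, h', ofLevel_mul_of_odd (by decide) (by decide), H, add_zero, map_zero]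
  | e_f i j =>
    have hl : LocalPair (Gen.e i : Gen n).level (Gen.f j : Gen n).level := by
      rcases level_e i with ⟨-, h⟩ | ⟨-, h⟩ <;> rcases level_f j with ⟨-, h'⟩ | ⟨-, h'⟩ <;>
        simp [LocalPair, h, h']
    refine (((isCompatible_gen (.e i)).mul (isCompatible_gen (.f j)) hl rfl).sub ?_).eq_zero h0
    split_ifs with hij
    · subst hij
      refine comp _ _ ?_
      rcases level_e i with ⟨hi, h⟩ | ⟨hi, h⟩ <;> rcases level_f i with ⟨hi', h'⟩ | ⟨hi', h'⟩
      · rw [h, h']; rfl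
      · exact absurd hi hi'
      · exact absurd hi' hi
      · rw [h, h']; rfl
    · exact .zero _

/-- The representation of `U_{n+1}` on the quadratic algebra. -/
theorem exists_quadAlg_representation (E : Module.Basis ι ℝ (level n (-1))) :
    ∃ Φ : U n →ₗ[ℝ] SuperComm (Module.End ℝ (QuadAlg E)), (∀ x y, Φ ⁅x, y⁆ = Φ x * Φ y) ∧
      ∀ M, Φ (E M) = ofLevel (-1) (LinearMap.mulLeft ℝ (qgen E M)) := by
  obtain ⟨Φ, hΦ, hgen⟩ := exists_lift (genOp E) fun x hx => freeLift_genOp_eq_zero hx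
  -- Φ is prescribed only on generators. The locus where it agrees with the local operators is a
  -- local subalgebra, hence the whole local part, and so contains every E_M.
  let C : ℤ → Submodule ℝ (U n) := fun p =>
    (LinearMap.eqLocus (Φ ∘ₗ (level n p).subtype) (ofLevel p ∘ₗ localOp E p)).map
      (level n p).subtype
  have hC : IsLocalSubalgebra C := by
    refine ⟨fun p => Submodule.map_subtype_le _ _, fun g => ?_, ?_⟩
    · exact ⟨⟨_, gen_mem_level g⟩, hgen g, rfl⟩
    · rintro p q hpq _ ⟨x, hx, rfl⟩ _ ⟨y, hy, rfl⟩
      have hx : Φ x = ofLevel p (localOp E p x) := hx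
      have hy : Φ y = ofLevel q (localOp E q y) := hy
      have hxy := bracket_mem_level x.2 y.2
      refine ⟨⟨_, hxy⟩, ?_, rfl⟩
      change Φ ⁅(x : U n), (y : U n)⁆ = ofLevel (p + q) (localOp E (p + q) ⟨_, hxy⟩)
      rw [hΦ, hx, hy, ofLevel_localOp_mul hpq rfl]
  refine ⟨Φ, hΦ, fun M => ?_⟩
  have hM : (E M : U n) ∈ C (-1) := by rw [hC.eq_level _ (by simp)]; exact (E M).2
  obtain ⟨x, hx, hxM⟩ := hM
  have hx : Φ x = ofLevel (-1) (localOp E (-1) x) := hx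
  obtain rfl : x = E M := Subtype.ext hxM
  rw [hx]
  congr 1
  refine LinearMap.ext fun w => ?_
  rw [localOp_neg_one_apply, qlin_basis, LinearMap.mulLeft_apply]

/-- The iterated super commutators of the generators of the quadratic algebra. -/
noncomputable def qnested (E : Module.Basis ι ℝ (level n (-1))) :
    (k : ℕ) → (Fin k → ι) → QuadAlg E
  | 0, _ => 0
  | 1, M => qgen E (M 0)
  | k + 2, M => qgen E (M 0) * qnested E (k + 1) (Fin.tail M) -
      koszulSign (-1) (-(k + 1 : ℕ)) • (qnested E (k + 1) (Fin.tail M) * qgen E (M 0))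

/-- In the representation E_{M₁…M_k} is left multiplication by the iterated super commutator, which
is recovered by acting on 1. Hence every relation at level -k is a consequence of the relations at
level -2. -/
theorem sum_qnested_eq_zero {k : ℕ} {c : (Fin k → ι) → ℝ}
    (hc : ∑ M, c M • nestedE E M = 0) : ∑ M, c M • qnested E k M = 0 := by
  obtain ⟨Φ, hΦ, hE⟩ := exists_quadAlg_representation E
  have key : ∀ (k : ℕ) (M : Fin k → ι),
      Φ (nestedE E M) = ofLevel (-k) (LinearMap.mulLeft ℝ (qnested E k M)) := by
    intro k
    induction k using Nat.twoStepInduction with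
    | zero => intro M; simp [nestedE, nested, qnested]
    | one => intro M; exact hE (M 0)
    | more k _ ih =>
      intro M
      have h1 : nestedE E M = ⁅(E (M 0) : U n), nestedE E (Fin.tail M)⁆ := rfl
      rw [h1, hΦ, hE, ih, ofLevel_mul,
        show (-1 : ℤ) + -((k + 1 : ℕ) : ℤ) = -((k + 2 : ℕ) : ℤ) by push_cast; ring]
      congr 1
      refine LinearMap.ext fun w => ?_
      simp [qnested, sub_mul, mul_assoc]
  have h := congrArg Φ hc
  simp only [map_sum, map_smul, key, map_zero] at h
  simp only [← map_smul, ← map_sum] at h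
  have h2 := ofLevel_injective _ (h.trans (map_zero _).symm)
  have h3 := LinearMap.congr_fun h2 1
  simpa [LinearMap.sum_apply] using h3

end Representation

/-! ### Derivations of tensors -/

section Derivation

variable {n : ℕ} {ι : Type*}

theorem map_derivation {V W : Type*} [AddCommMonoid V] [AddCommMonoid W] (f : V →+ W)
    (x : ι → ι → V) {k : ℕ} (N Q : Fin k → ι) :
    f (derivation x N Q) = derivation (fun r s => f (x r s)) N Q := by
  simp only [derivation, map_sum]
  refine Finset.sum_congr rfl fun i _ => ?_
  split_ifs <;> simp

theorem sum_derivation_smul [Fintype ι] [DecidableEq ι] {V : Type*} [AddCommGroup V] [Module ℝ V]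
    (m : ι → ι → ℝ) {k : ℕ} (M : Fin k → ι) (g : (Fin k → ι) → V) :
    ∑ Q, derivation m M Q • g Q = ∑ i, ∑ p, m (M i) p • g (Function.update M i p) := by
  simp only [derivation, Finset.sum_smul]
  rw [Finset.sum_comm]
  refine Finset.sum_congr rfl fun i _ => ?_
  simp only [ite_smul, zero_smul]
  rw [← Finset.sum_filter]
  -- The i-th summand survives exactly when Q agrees with M away from i, i.e. when Q is an update of
  -- M at i.
  refine (Finset.sum_bij (fun p _ => Function.update M i p) ?_ ?_ ?_ ?_).symm
  · intro p _
    simp only [Finset.mem_filter, Finset.mem_univ, true_and]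
    intro j hj
    rw [Function.update_of_ne hj]
  · intro p _ p' _ h
    simpa using congrFun h i
  · intro Q hQ
    simp only [Finset.mem_filter, Finset.mem_univ, true_and] at hQ
    refine ⟨Q i, Finset.mem_univ _, ?_⟩
    funext j
    by_cases hj : j = i
    · subst hj; simp
    · rw [Function.update_of_ne hj, hQ j hj]
  · intro p _
    simp

theorem bracket_nested [Fintype ι] {v : ι → U n} {σ : ℤ} (hv : ∀ i, v i ∈ level n σ) {s : U n}
    (hs : s ∈ level n 0) {m : ι → ι → ℝ} (hm : ∀ i, ⁅s, v i⁆ = ∑ p, m i p • v p) (k : ℕ)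
    (M : Fin k → ι) : ⁅s, nested v k M⁆ = ∑ Q, derivation m M Q • nested v k Q := by
  classical
  rw [sum_derivation_smul]
  induction k using Nat.twoStepInduction with
  | zero => simp [nested]
  | one => simp [nested, hm]
  | more k _ ih =>
    rw [Fin.sum_univ_succ, nested, bracket_jacobi_zero hs (hv _), hm, ih]
    simp only [nested, Function.update_self, Fin.tail_update_zero, Fin.tail_update_succ,
      sum_bracket, bracket_sum, smul_bracket, bracket_smul]
    congr 1

end Derivation

/-! ### The derivation given by an embedding tensor -/

section EmbeddingDerivation

variable {n : ℕ} {ι : Type*}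

/-- The values on iterated brackets of the odd derivation that sends `E_M` to `-X_M`. -/
noncomputable def embeddingDer (E : Module.Basis ι ℝ (level n (-1))) (X : ι → U n) :
    (k : ℕ) → (Fin k → ι) → U n
  | 0, _ => 0
  | 1, M => -X (M 0)
  | k + 2, M => -⁅X (M 0), nestedE E (Fin.tail M)⁆ -
      ⁅(E (M 0) : U n), embeddingDer E X (k + 1) (Fin.tail M)⁆

variable {E : Module.Basis ι ℝ (level n (-1))} {X : ι → U n}

theorem embeddingDer_mem (hX : ∀ M, X M ∈ level n 0) :
    ∀ (k : ℕ) (M : Fin (k + 1) → ι), embeddingDer E X (k + 1) M ∈ level n (-k)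
  | 0, M => by simpa [embeddingDer] using hX (M 0)
  | k + 1, M => by
    rw [embeddingDer]
    refine sub_mem (neg_mem (bracket_level_zero_mem (hX _) (nestedE_mem E _))) ?_
    have := bracket_mem_level (basis_mem_level (E := E) (M 0))
      (embeddingDer_mem hX k (Fin.tail M))
    rwa [show -((k + 1 : ℕ) : ℤ) = -1 + -(k : ℤ) by push_cast; ring]

theorem nestedE_succ (E : Module.Basis ι ℝ (level n (-1))) {k : ℕ} (M : Fin (k + 2) → ι) :
    nestedE E M = ⁅(E (M 0) : U n), nestedE E (Fin.tail M)⁆ := rfl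

theorem nestedF_succ (F : Module.Basis ι ℝ (level n 1)) {k : ℕ} (M : Fin (k + 2) → ι) :
    nestedF F M = ⁅(F (M 0) : U n), nestedF F (Fin.tail M)⁆ := rfl

theorem koszulSign_neg_one_succ (k : ℕ) :
    koszulSign (-1) (-((k + 1 : ℕ) : ℤ)) = -koszulSign (-1) (-(k : ℤ)) := by
  have h1 : Odd (-1 : ℤ) := by decide
  rcases Int.even_or_odd (k : ℤ) with hk | hk
  · rw [koszulSign_comm _ (-(k : ℤ)), koszulSign_of_even_left hk.neg, koszulSign_of_odd h1]
    push_cast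
    exact hk.add_one.neg
  · rw [koszulSign_of_odd h1 hk.neg, koszulSign_comm, koszulSign_of_even_left, neg_neg]
    push_cast
    exact hk.add_one.neg

/-- The action of `E_M` on `U_{n+1} ⊗ ℝ[θ]/θ²` with `θ` odd, twisted by the embedding tensor. -/
noncomputable def twistedAd (E : Module.Basis ι ℝ (level n (-1))) (X : ι → U n) (M : ι) :
    Module.End ℝ (U n × U n) :=
  LinearMap.prod (bracketHom n (E M) ∘ₗ LinearMap.fst ℝ _ _)
    (-(bracketHom n (X M) ∘ₗ LinearMap.fst ℝ _ _) -
      bracketHom n (E M) ∘ₗ LinearMap.snd ℝ _ _)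

theorem twistedAd_apply (M : ι) (y z : U n) :
    twistedAd E X M (y, z) = (⁅(E M : U n), y⁆, -⁅X M, y⁆ - ⁅(E M : U n), z⁆) := rfl

/-- By `hrel` the operators `twistedAd` satisfy the quadratic relations, so they extend to the
quadratic algebra, to which `sum_qnested_eq_zero` carries the relation `hc`. The off-diagonal entry
of the image of an iterated super commutator is the adjoint action of `embeddingDer`; this is why
only brackets with `y` are controlled here. -/
theorem bracket_sum_embeddingDer [Fintype ι] (hX : ∀ M, X M ∈ level n 0)
    (hrel : ∀ c, IsQuadRelation E c →
      ∑ k, c k • (⁅X k.1, (E k.2 : U n)⁆ + ⁅X k.2, (E k.1 : U n)⁆) = 0)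
    {k : ℕ} {c : (Fin k → ι) → ℝ} (hc : ∑ M, c M • nestedE E M = 0) (y : U n) :
    ⁅∑ M, c M • embeddingDer E X k M, y⁆ = 0 := by
  obtain ⟨Ψ, hΨ⟩ := exists_quadAlg_lift (E := E) (twistedAd E X) (by
    intro c hc
    refine LinearMap.ext fun ⟨y, z⟩ => ?_
    have hterm : ∀ k : ι × ι, (twistedAd E X k.1 * twistedAd E X k.2 +
        twistedAd E X k.2 * twistedAd E X k.1) (y, z) =
        (⁅⁅(E k.1 : U n), (E k.2 : U n)⁆, y⁆,
          -⁅⁅X k.1, (E k.2 : U n)⁆ + ⁅X k.2, (E k.1 : U n)⁆, y⁆ +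
            ⁅⁅(E k.1 : U n), (E k.2 : U n)⁆, z⁆) := by
      rintro ⟨M, N⟩
      simp only [LinearMap.add_apply, Module.End.mul_apply, twistedAd_apply, add_bracket]
      rw [bracket_jacobi (basis_mem_level M) (basis_mem_level N),
        bracket_jacobi (basis_mem_level M) (basis_mem_level N),
        bracket_jacobi (hX M) (basis_mem_level N), bracket_jacobi (hX N) (basis_mem_level M),
        koszulSign_of_odd (by decide) (by decide)]
      refine Prod.ext ?_ ?_
      · simp
      · simp only [Prod.snd_add, koszulSign_zero_left, bracket_sub, bracket_neg]
        module
    simp only [LinearMap.sum_apply, LinearMap.smul_apply, hterm, LinearMap.zero_apply]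
    have h1 : ∀ y : U n, ∑ k, c k • ⁅⁅(E k.1 : U n), (E k.2 : U n)⁆, y⁆ = 0 := by
      intro y
      have hc' : ∑ k, c k • ⁅(E k.1 : U n), (E k.2 : U n)⁆ = 0 := hc
      simpa using congrArg (fun u : U n => ⁅u, y⁆) hc'
    have h2 := congrArg (fun u : U n => ⁅u, y⁆) (hrel c hc)
    simp only [sum_bracket, smul_bracket, zero_bracket] at h2
    refine Prod.ext ?_ ?_
    · simpa [Prod.fst_sum] using h1 y
    · simp only [Prod.snd_sum, Prod.smul_snd, smul_add, smul_neg, Finset.sum_add_distrib,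
        Finset.sum_neg_distrib, h1 z, Prod.snd_zero, add_zero, neg_eq_zero]
      simpa [Finset.sum_add_distrib] using h2)
  -- The image is triangular in (y, z), with the sign of an odd θ passing E_{M₁…M_k} on the second
  -- diagonal entry; z = 0 isolates the off-diagonal entry.
  have key : ∀ (k : ℕ) (M : Fin k → ι) (y z : U n), Ψ (qnested E k M) (y, z) =
      (⁅nestedE E M, y⁆, ⁅embeddingDer E X k M, y⁆ +
        koszulSign (-1) (-(k : ℤ)) • ⁅nestedE E M, z⁆) := by
    intro k
    induction k using Nat.twoStepInduction with
    | zero => intro M y z; simp [nestedE, nested, qnested, embeddingDer, Prod.ext_iff]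
    | one =>
      intro M y z
      rw [qnested, hΨ, twistedAd_apply]
      simp only [embeddingDer, nestedE, nested]
      rw [koszulSign_of_odd (by decide) (by decide)]
      refine Prod.ext rfl ?_
      simp only [neg_bracket]
      module
    | more k _ ih =>
      intro M y z
      have hD := embeddingDer_mem (E := E) hX k (Fin.tail M)
      have hN := nestedE_mem E (Fin.tail M)
      have hE := basis_mem_level (E := E) (M 0)
      have hs := koszulSign_mul_self (-1) (-(k : ℤ))
      rw [qnested, map_sub, map_smul, map_mul, map_mul, hΨ]
      simp only [LinearMap.sub_apply, LinearMap.smul_apply, Module.End.mul_apply, ih,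
        twistedAd_apply, embeddingDer, nestedE_succ, sub_bracket, neg_bracket]
      rw [bracket_jacobi hE hN, bracket_jacobi hE hN, bracket_jacobi hE hD,
        bracket_jacobi (hX (M 0)) hN, koszulSign_neg_one_succ (k + 1), koszulSign_neg_one_succ k]
      refine Prod.ext ?_ ?_
      · simp
      · simp only [Prod.snd_sub, Prod.smul_snd, koszulSign_zero_left, bracket_sub, bracket_neg,
          bracket_add, bracket_smul]
        obtain h | h := mul_self_eq_one_iff.1 hs <;> rw [h] <;> module
  have h := congrArg Ψ (sum_qnested_eq_zero hc)
  have h2 := congrArg Prod.snd (LinearMap.congr_fun h (y, 0))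
  simpa [map_sum, LinearMap.sum_apply, Prod.snd_sum, key] using h2

end EmbeddingDerivation

/-! ### Consequences of the invariance of the form -/

section Form

variable {n : ℕ} {ι : Type*} [Fintype ι]

theorem sum_smul_ite_head {V : Type*} [AddCommGroup V] [Module ℝ V] {k : ℕ} (m : ι)
    [∀ Q : Fin (k + 1) → ι, Decidable (m = Q 0)] (f : (Fin (k + 1) → ι) → ℝ)
    (g : (Fin k → ι) → V) :
    ∑ Q, f Q • (if m = Q 0 then g (Fin.tail Q) else 0) = ∑ Q, f (Fin.cons m Q) • g Q := by
  classical
  rw [← (Fin.consEquiv fun _ => ι).sum_comp, Fintype.sum_prod_type]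
  simp only [Fin.consEquiv, Equiv.coe_fn_mk, Fin.cons_zero, Fin.tail_cons, smul_ite, smul_zero]
  rw [Finset.sum_comm]
  refine Finset.sum_congr rfl fun Q _ => ?_
  rw [Finset.sum_eq_single m]
  · simp
  · intro b _ hb
    rw [if_neg hb.symm]
  · simp

theorem sum_fin_one {V : Type*} [AddCommMonoid V] (g : (Fin 1 → ι) → V) :
    ∑ Q, g Q = ∑ i, g fun _ => i := by
  rw [← (Equiv.funUnique (Fin 1) ι).symm.sum_comp]
  rfl

theorem exists_nestedE_expansion (E : Module.Basis ι ℝ (level n (-1))) {k : ℕ} {y : U n}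
    (hy : y ∈ level n (-(k + 1 : ℕ))) :
    ∃ d : (Fin (k + 1) → ι) → ℝ, y = ∑ M, d M • nestedE E M := by
  obtain ⟨d, hd⟩ := (Submodule.mem_span_range_iff_exists_fun ℝ).1 (level_neg_le_span E k hy)
  exact ⟨d, hd.symm⟩

theorem exists_nestedF_expansion (F : Module.Basis ι ℝ (level n 1)) {k : ℕ} {y : U n}
    (hy : y ∈ level n (k + 1 : ℕ)) :
    ∃ d : (Fin (k + 1) → ι) → ℝ, y = ∑ M, d M • nestedF F M := by
  obtain ⟨d, hd⟩ := (Submodule.mem_span_range_iff_exists_fun ℝ).1 (level_natCast_le_span F k hy)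
  exact ⟨d, hd.symm⟩

variable [DecidableEq ι]

/-- An invariant form for which the chosen bases of levels `-1` and `1` are dual to each other and
which, between the levels `-k` and `k`, is a nonzero multiple of the projector for `2 ≤ k ≤ K`. -/
structure IsProjectorForm (B : U n →ₗ[ℝ] U n →ₗ[ℝ] ℝ) (E : Module.Basis ι ℝ (level n (-1)))
    (F : Module.Basis ι ℝ (level n 1)) (P : (k : ℕ) → Matrix (Fin k → ι) (Fin k → ι) ℝ)
    (a : ℕ → ℝ) (K : ℕ) : Prop where
  isInvariantForm : IsInvariantForm n B
  dual : ∀ M N : ι, B (E M) (F N) = if M = N then 1 else 0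
  projector : ∀ k, 2 ≤ k → k ≤ K → IsLevelProjector E F k (P k)
  one : a 1 = 1
  ne_zero : ∀ k, 2 ≤ k → k ≤ K → a k ≠ 0
  form : ∀ k, 2 ≤ k → k ≤ K → ∀ M N : Fin k → ι, B (nestedE E M) (nestedF F N) = a k * P k M N

variable {B : U n →ₗ[ℝ] U n →ₗ[ℝ] ℝ} {E : Module.Basis ι ℝ (level n (-1))}
  {F : Module.Basis ι ℝ (level n 1)} {P : (k : ℕ) → Matrix (Fin k → ι) (Fin k → ι) ℝ}
  {a : ℕ → ℝ} {K : ℕ}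

namespace IsProjectorForm

theorem eq_sum_E (h : IsProjectorForm B E F P a K) {y : U n} (hy : y ∈ level n (-1)) :
    y = ∑ M, B y (F M) • (E M : U n) := by
  induction hy using level_neg_one_induction (E := E) with
  | hE M => simp [h.dual]
  | h0 => simp
  | hadd x y _ _ hx hy =>
    simp only [map_add, LinearMap.add_apply, add_smul, Finset.sum_add_distrib]
    rw [← hx, ← hy]
  | hsmul c x _ hx =>
    simp only [map_smul, LinearMap.smul_apply, smul_assoc, ← Finset.smul_sum]
    rw [← hx]

/-- For k ≥ 2 the coefficients are those of the projector. By idempotency the coefficient tensor δ_R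
- P_R is killed by the projector, so it gives a vanishing combination of the E_Q. -/
theorem sum_form_smul_nestedE (h : IsProjectorForm B E F P a K) {k : ℕ} (h1 : 1 ≤ k) (hk : k ≤ K)
    (R : Fin k → ι) :
    ∑ Q : Fin k → ι, ((a k)⁻¹ * B (nestedE E R) (nestedF F Q)) • nestedE E Q = nestedE E R := by
  obtain rfl | h2 := h1.eq_or_lt
  · rw [sum_fin_one, h.one, inv_one]
    simp only [one_mul]
    exact (h.eq_sum_E (basis_mem_level (R 0))).symm
  · have hP := h.projector k h2 hk
    have hc := (hP.lower fun Q => (if Q = R then 1 else 0) - P k R Q).1 (by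
      rw [show (fun Q => (if Q = R then 1 else 0) - P k R Q) =
        (Pi.single R 1 : (Fin k → ι) → ℝ) - P k R by ext; simp [Pi.single_apply], Matrix.sub_vecMul, Matrix.single_one_vecMul, sub_eq_zero]
      exact (congrFun hP.idempotent R).symm)
    simp only [sub_smul, Finset.sum_sub_distrib, ite_smul, one_smul,
      zero_smul, Finset.sum_ite_eq', Finset.mem_univ, if_true] at hc
    rw [eq_comm, ← sub_eq_zero, ← hc]
    simp only [h.form k h2 hk, inv_mul_cancel_left₀ (h.ne_zero k h2 hk)]

theorem eq_zero_of_forall_nestedF (h : IsProjectorForm B E F P a K) {k : ℕ} (h1 : 1 ≤ k)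
    (hk : k ≤ K) {y : U n} (hy : y ∈ level n (-k)) (hB : ∀ N : Fin k → ι, B y (nestedF F N) = 0) :
    y = 0 := by
  obtain ⟨k, rfl⟩ := Nat.exists_eq_add_of_le' h1
  obtain ⟨d, rfl⟩ := exists_nestedE_expansion E hy
  rw [← Finset.sum_congr rfl fun M _ => congrArg (d M • ·) (h.sum_form_smul_nestedE h1 hk M)]
  simp only [map_sum, map_smul, LinearMap.sum_apply, LinearMap.smul_apply] at hB
  simp only [Finset.smul_sum, smul_smul]
  rw [Finset.sum_comm]
  refine Finset.sum_eq_zero fun N _ => ?_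
  rw [← Finset.sum_smul]
  have : ∑ M, d M * ((a (k + 1))⁻¹ * B (nestedE E M) (nestedF F N)) =
      (a (k + 1))⁻¹ * ∑ M, d M • B (nestedE E M) (nestedF F N) := by
    rw [Finset.mul_sum]
    exact Finset.sum_congr rfl fun M _ => by rw [smul_eq_mul]; ring
  rw [this, hB, mul_zero, zero_smul]

theorem eq_zero_of_forall_nestedE (h : IsProjectorForm B E F P a K) {k : ℕ} (h1 : 1 ≤ k)
    (hk : k ≤ K) {y : U n} (hy : y ∈ level n k) (hB : ∀ N : Fin k → ι, B (nestedE E N) y = 0) :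
    y = 0 := by
  obtain ⟨k, rfl⟩ := Nat.exists_eq_add_of_le' h1
  obtain ⟨d, rfl⟩ := exists_nestedF_expansion F hy
  simp only [map_sum, map_smul] at hB
  obtain h0 | h2 := h1.eq_or_lt
  · obtain rfl : k = 0 := by omega
    refine Finset.sum_eq_zero fun N _ => ?_
    have := hB N
    rw [sum_fin_one] at this
    have hd : ∀ i, B (nestedE E N) (nestedF F fun _ : Fin 1 => i) = if N 0 = i then 1 else 0 :=
      fun i => h.dual (N 0) i
    simp only [hd, smul_eq_mul, mul_ite, mul_one, mul_zero, Finset.sum_ite_eq, Finset.mem_univ,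
      if_true] at this
    rw [show N = fun _ => N 0 from funext fun i => congrArg N (Fin.ext (by omega)), this, zero_smul]
  · refine ((h.projector _ h2 hk).upper d).1 (funext fun N => ?_)
    have := hB N
    simp only [h.form _ h2 hk, smul_eq_mul] at this
    have ha := h.ne_zero _ h2 hk
    rw [Pi.zero_apply, ← mul_right_inj' ha, mul_zero, ← this, Matrix.mulVec, dotProduct,
      Finset.mul_sum]
    exact Finset.sum_congr rfl fun M _ => by ring

/-- Elements of the levels `-2, …, -K` that commute with everything vanish. -/
theorem eq_zero_of_forall_bracket (h : IsProjectorForm B E F P a K) {k : ℕ} (h2 : 2 ≤ k)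
    (hk : k ≤ K) {y : U n} (hy : y ∈ level n (-k)) (hy0 : ∀ x : U n, ⁅y, x⁆ = 0) : y = 0 := by
  refine h.eq_zero_of_forall_nestedF (by omega) hk hy fun N => ?_
  obtain ⟨k, rfl⟩ := Nat.exists_eq_add_of_le' h2
  rw [nestedF_succ, ← h.isInvariantForm.invariant, hy0, map_zero, LinearMap.zero_apply]

/-- For F in level 1, ⟨[z, E_m]|F⟩ = ⟨z|[E_m, F]⟩ = 0, and levels -1 and 1 are dual. So an identity
at level 0 may be tested against the form before bracketing with E_m, without nondegeneracy of the
form at level 0. -/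
theorem bracket_E_eq_zero (h : IsProjectorForm B E F P a K) (hK : 1 ≤ K) {z : U n}
    (hz : z ∈ level n 0) (hB : ∀ s ∈ level n 0, B s z = 0) (m : ι) : ⁅(E m : U n), z⁆ = 0 := by
  have hzm := bracket_level_zero_mem hz (basis_mem_level (E := E) m)
  rw [← neg_eq_zero, ← bracket_skew_zero hz (basis_mem_level (E := E) m)]
  refine h.eq_zero_of_forall_nestedF le_rfl hK (by simpa using hzm) fun N => ?_
  have hF : nestedF F N ∈ level n 1 := by simpa using nestedF_mem F N
  have hEF : ⁅(E m : U n), nestedF F N⁆ ∈ level n 0 := by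
    simpa using bracket_mem_level (basis_mem_level (E := E) m) hF
  rw [h.isInvariantForm.invariant, h.isInvariantForm.supersymm 0 0 _ hz _ hEF, hB _ hEF, mul_zero]

/-! ### The recursion formulas -/

theorem bracket_nestedE_nestedF_mem {κ : Type*} {E : Module.Basis κ ℝ (level n (-1))}
    {F : Module.Basis κ ℝ (level n 1)} {k : ℕ} (N Q : Fin k → κ) :
    ⁅nestedE E N, nestedF F Q⁆ ∈ level n 0 := by
  simpa using bracket_mem_level (nestedE_mem E N) (nestedF_mem F Q)

/-- Invariance moves `s` onto E_N, where it acts as a derivation; duality of the bases identifies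
its matrix on level -1 as ⟨s|[E_r, F^t]⟩. -/
theorem form_bracket_nestedE_nestedF (h : IsProjectorForm B E F P a K) {k : ℕ} (h2 : 2 ≤ k)
    (hk : k ≤ K) {s : U n} (hs : s ∈ level n 0) (N Q : Fin k → ι) :
    (a k)⁻¹ * B s ⁅nestedE E N, nestedF F Q⁆ =
      ∑ M, P k M Q * derivation (fun r t => B s ⁅(E r : U n), (F t : U n)⁆) N M := by
  have hm : ∀ i, ⁅s, (E i : U n)⁆ = ∑ p, B s ⁅(E i : U n), (F p : U n)⁆ • (E p : U n) := by
    intro i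
    rw [h.eq_sum_E (bracket_level_zero_mem hs (basis_mem_level (E := E) i))]
    simp only [h.isInvariantForm.invariant]
  rw [← h.isInvariantForm.invariant, nestedE, bracket_nested (fun i => (E i).2) hs hm]
  simp only [map_sum, map_smul, LinearMap.sum_apply, LinearMap.smul_apply, smul_eq_mul,
    Finset.mul_sum]
  refine Finset.sum_congr rfl fun M _ => ?_
  have := h.form k h2 hk M Q
  rw [nestedE] at this
  rw [this]
  field_simp [h.ne_zero k h2 hk]

theorem elementX_eq (h : IsProjectorForm B E F P a K) {k : ℕ} (h2 : 2 ≤ k) (hk : k ≤ K) (m : ι)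
    (N Q : Fin k → ι) :
    elementX E F a m N Q = projUpper (P k)
      (derivation (fun r s => elementX E F a m (fun _ : Fin 1 => r) (fun _ => s)) N) Q := by
  have hmem1 : ∀ r s : ι, ⁅(E r : U n), (F s : U n)⁆ ∈ level n 0 := fun r s => by
    simpa using bracket_mem_level (E r).2 (F s).2
  have hder : ∀ M, derivation (fun r s => ⁅(E r : U n), (F s : U n)⁆) N M ∈ level n 0 := by
    intro M
    refine sum_mem fun i _ => ?_
    split_ifs
    exacts [hmem1 _ _, zero_mem _]
  have h0 := h.bracket_E_eq_zero (by omega)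
    (z := (a k)⁻¹ • ⁅nestedE E N, nestedF F Q⁆ -
      ∑ M, P k M Q • derivation (fun r s => ⁅(E r : U n), (F s : U n)⁆) N M)
    (sub_mem (Submodule.smul_mem _ _ (bracket_nestedE_nestedF_mem N Q))
      (sum_mem fun M _ => Submodule.smul_mem _ _ (hder M))) (by
      intro s hs
      simp only [map_sub, map_sum, map_smul, smul_eq_mul,
        h.form_bracket_nestedE_nestedF h2 hk hs]
      rw [sub_eq_zero]
      refine Finset.sum_congr rfl fun M _ => ?_
      congr 1
      exact (map_derivation (B s).toAddMonoidHom _ N M).symm) m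
  rw [bracket_sub, sub_eq_zero, bracket_smul, bracket_sum] at h0
  rw [elementX, h0, projUpper]
  refine Finset.sum_congr rfl fun M _ => ?_
  rw [bracket_smul]
  congr 1
  refine (map_derivation (bracketHom n (E m)).toAddMonoidHom _ N M).trans ?_
  congr 1
  funext r s
  simp only [elementX, h.one, inv_one, one_smul]
  rfl

/-- Both sides are paired with E_R. Invariance turns the left side into -⟨⟦E_m, E_R⟧|F^N⟩, and
replacing E_R by its expansion in `sum_form_smul_nestedE` produces the coefficients of the right
side. -/
theorem bracket_nestedF_E (h : IsProjectorForm B E F P a K) {k : ℕ} (h1 : 1 ≤ k) (hk : k + 1 ≤ K)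
    (N : Fin (k + 1) → ι) (m : ι) :
    (a (k + 1))⁻¹ • ⁅nestedF F N, (E m : U n)⁆ =
      -∑ Q : Fin k → ι, P (k + 1) (Fin.cons m Q) N • (a k)⁻¹ • nestedF F Q := by
  obtain ⟨k, rfl⟩ := Nat.exists_eq_add_of_le' h1
  have hF := nestedF_mem F N
  have hEm := basis_mem_level (E := E) m
  have hFE : ⁅nestedF F N, (E m : U n)⁆ ∈ level n (k + 1 : ℕ) := by
    have := bracket_mem_level hF hEm
    rwa [show ((k + 1 + 1 : ℕ) : ℤ) + -1 = (k + 1 : ℕ) by push_cast; ring] at this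
  rw [← add_eq_zero_iff_eq_neg]
  refine h.eq_zero_of_forall_nestedE h1 (by omega) (add_mem (Submodule.smul_mem _ _ hFE)
    (sum_mem fun Q _ => Submodule.smul_mem _ _ (Submodule.smul_mem _ _ (nestedF_mem F Q)))) ?_
  intro R
  have e1 : B (nestedE E R) ⁅nestedF F N, (E m : U n)⁆ =
      -B ⁅(E m : U n), nestedE E R⁆ (nestedF F N) := by
    -- The two levels are consecutive, so exactly one of these signs is -1.
    have hs : koszulSign ((k + 1 + 1 : ℕ) : ℤ) (-1) * koszulSign (-((k + 1 : ℕ) : ℤ)) (-1) = -1 := by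
      rcases Int.even_or_odd ((k + 1 : ℕ) : ℤ) with hp | hp
      · rw [koszulSign_of_even_left hp.neg, koszulSign_of_odd _ (by decide), mul_one]
        push_cast at hp ⊢
        exact hp.add_one
      · rw [koszulSign_of_odd hp.neg (by decide), koszulSign_of_even_left, one_mul]
        push_cast at hp ⊢
        exact hp.add_one
    rw [bracket_skew hF hEm, map_neg, map_smul, ← h.isInvariantForm.invariant,
      bracket_skew (nestedE_mem E R) hEm, map_neg, map_smul, LinearMap.neg_apply,
      LinearMap.smul_apply, smul_neg, neg_neg, smul_smul, hs, neg_one_smul]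
  have e2 : ⁅(E m : U n), nestedE E R⁆ = ∑ Q : Fin (k + 1) → ι, ((a (k + 1))⁻¹ *
      B (nestedE E R) (nestedF F Q)) • nestedE E (Fin.cons m Q : Fin (k + 2) → ι) := by
    conv_lhs => rw [← h.sum_form_smul_nestedE h1 (by omega) R]
    rw [bracket_sum]
    refine Finset.sum_congr rfl fun Q _ => ?_
    rw [bracket_smul]
    rfl
  have ha := h.ne_zero (k + 2) (by omega) hk
  rw [map_add, map_smul, e1, e2, map_sum, map_sum, LinearMap.sum_apply, smul_neg, Finset.smul_sum,
    neg_add_eq_zero]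
  refine Finset.sum_congr rfl fun Q _ => ?_
  simp only [map_smul, LinearMap.smul_apply, smul_eq_mul, h.form (k + 2) (by omega) hk]
  field_simp

/-- The Jacobi identity moves F^N past E_{M₁}. The bracket ⟦F^N, E_{M₁}⟧ is given by
`bracket_nestedF_E`, and the other term is X up to two signs whose product is 1. -/
theorem elementY_eq (h : IsProjectorForm B E F P a K) {k : ℕ} (h1 : 1 ≤ k) (hk : k + 1 ≤ K)
    (N : Fin (k + 1) → ι) (M : Fin (k + 2) → ι) :
    elementY E F a N M = - projUpper (P (k + 1))
        (fun Q => if M 0 = Q 0 then elementY E F a (Fin.tail Q) (Fin.tail M) else 0) N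
      - elementX E F a (M 0) (Fin.tail M) N := by
  have hF := nestedF_mem F N
  have hE := nestedE_mem E (Fin.tail M)
  have hEm := basis_mem_level (E := E) (M 0)
  have hs : koszulSign ((k + 1 : ℕ) : ℤ) (-1) *
      koszulSign ((k + 1 : ℕ) : ℤ) (-((k + 1 : ℕ) : ℤ)) = 1 := by
    rcases Int.even_or_odd ((k + 1 : ℕ) : ℤ) with hp | hp
    · rw [koszulSign_of_even_left hp, koszulSign_of_even_left hp, one_mul]
    · rw [koszulSign_of_odd hp (by decide), koszulSign_of_odd hp hp.neg]
      norm_num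
  have e := sum_smul_ite_head (M 0) (fun Q => P (k + 1) Q N)
    fun Q => elementY E F a Q (Fin.tail M)
  rw [projUpper, e, elementY, nestedE_succ, bracket_jacobi' hF hEm, smul_add, ← smul_bracket,
    h.bracket_nestedF_E h1 hk, bracket_skew hF hE, bracket_neg, bracket_smul, smul_neg, smul_smul,
    hs, one_smul, neg_bracket, sum_bracket, smul_neg, ← sub_eq_add_neg]
  simp only [smul_bracket]
  rfl

theorem elementY_one_eq (h : IsProjectorForm B E F P a K) (m r s : ι) :
    elementY E F a (fun _ : Fin 1 => m) ![r, s] =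
      - elementX E F a r (fun _ : Fin 1 => s) (fun _ => m)
        - elementX E F a s (fun _ : Fin 1 => r) (fun _ => m) := by
  have hFE : ⁅(F m : U n), (E r : U n)⁆ ∈ level n 0 := by
    simpa using bracket_mem_level (F m).2 (E r).2
  simp only [elementY, elementX, h.one, inv_one, one_smul]
  change ⁅(F m : U n), ⁅(E r : U n), (E s : U n)⁆⁆ =
    -⁅(E r : U n), ⁅(E s : U n), (F m : U n)⁆⁆ - ⁅(E s : U n), ⁅(E r : U n), (F m : U n)⁆⁆
  have ho : Odd (1 : ℤ) := odd_one
  have ho' : Odd (-1 : ℤ) := by decide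
  rw [bracket_jacobi' (F m).2 (E r).2, koszulSign_of_odd ho ho',
    bracket_skew_zero hFE (E s).2, bracket_comm_of_odd ho ho' (F m).2 (E r).2,
    bracket_comm_of_odd ho ho' (F m).2 (E s).2]
  module

end IsProjectorForm

end Form

/-! ### Comparison of the tensor hierarchy with the levels of U_{n+1} -/

section Hierarchy

variable {n : ℕ} {ι : Type*} [Fintype ι] {E : Module.Basis ι ℝ (level n (-1))}

theorem bracket_En_E (t : En n) (N : ι) :
    ⁅(t : U n), (E N : U n)⁆ = ∑ Q, repMatrix E t N Q • (E Q : U n) := by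
  have := congrArg (Subtype.val) (E.sum_repr ⟨⁅(t : U n), (E N : U n)⁆,
    bracket_level_zero_mem (En_le_level_zero n t.2) (E N).2⟩)
  rw [Submodule.coe_sum] at this
  exact this.symm

theorem coe_En_mem (t : En n) : (t : U n) ∈ level n 0 := En_le_level_zero n t.2

theorem bracket_En_nestedE (t : En n) {k : ℕ} (M : Fin k → ι) :
    ⁅(t : U n), nestedE E M⁆ = ∑ Q, derivation (repMatrix E t) M Q • nestedE E Q :=
  bracket_nested (fun i => (E i).2) (coe_En_mem t) (bracket_En_E t) k M

theorem sum_mul_eq_zero_of_mem_levelRep {k : ℕ} {c T : (Fin k → ι) → ℝ}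
    (hc : ∑ M, c M • nestedE E M = 0) (hT : T ∈ levelRep E k) : ∑ M, c M * T M = 0 := by
  induction hT using Submodule.span_induction with
  | mem T hT =>
    obtain ⟨φ, rfl⟩ := hT
    simpa using congrArg φ hc
  | zero => simp
  | add S T _ _ hS hT => simp [mul_add, Finset.sum_add_distrib, hS, hT]
  | smul r T _ hT =>
    have : ∑ M, c M * (r • T) M = r * ∑ M, c M * T M := by
      rw [Finset.mul_sum]
      exact Finset.sum_congr rfl fun M _ => by rw [Pi.smul_apply, smul_eq_mul]; ring
    rw [this, hT, mul_zero]

/-- A tensor annihilated by all relations among the E_{M₁…M_k} is a functional on their span, which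
extends to U. With `sum_mul_eq_zero_of_mem_levelRep`, the conjugate of s_k is the annihilator of
these relations. -/
theorem mem_levelRep_of_forall {k : ℕ} {T : (Fin k → ι) → ℝ}
    (hT : ∀ c : (Fin k → ι) → ℝ, ∑ M, c M • nestedE E M = 0 → ∑ M, c M * T M = 0) :
    T ∈ levelRep E k := by
  classical
  obtain ⟨φ, hφ⟩ := exists_comp_eq_of_ker_le
    (Fintype.linearCombination ℝ fun M : Fin k → ι => nestedE E M)
    (Fintype.linearCombination ℝ T) (fun c hc => hT c hc)
  refine Submodule.subset_span ⟨φ, funext fun M => ?_⟩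
  have := hφ (Pi.single M 1)
  rw [Fintype.linearCombination_apply_single, Fintype.linearCombination_apply_single,
    one_smul, one_smul] at this
  exact this.symm

theorem eq_zero_of_sum_nestedE_one {c : (Fin 1 → ι) → ℝ} (hc : ∑ M, c M • nestedE E M = 0) :
    c = 0 := by
  rw [sum_fin_one] at hc
  have h1 : ∑ i, c (fun _ => i) • E i = 0 := by
    refine Subtype.ext ?_
    rw [Submodule.coe_sum]
    exact hc
  have h2 := Fintype.linearIndependent_iff.1 E.linearIndependent _ h1
  funext N
  rw [show N = fun _ => N 0 from funext fun i => congrArg N (Fin.ext (by omega))]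
  exact h2 (N 0)

theorem embeddingDer_two {κ : Type*} {E : Module.Basis κ ℝ (level n (-1))} (X : κ → En n)
    (M : Fin 2 → κ) :
    embeddingDer E (fun i => (X i : U n)) 2 M =
      -⁅(X (M 0) : U n), (E (M 1) : U n)⁆ - ⁅(X (M 1) : U n), (E (M 0) : U n)⁆ := by
  rw [bracket_skew_zero (coe_En_mem (X (M 1))) (E (M 0)).2, ← bracket_neg (E (M 0) : U n)]
  rfl

/-- The initial condition of the hierarchy lists the components of D on {E_M, E_N}; this links the
hypothesis on r_2 with the level -2 relations. -/
theorem embeddingDer_two_eq_sum (Pr : (k : ℕ) → Matrix (Fin k → ι) (Fin k → ι) ℝ) (X : ι → En n)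
    (M : Fin 2 → ι) :
    embeddingDer E (fun i => (X i : U n)) 2 M =
      ∑ N, hierarchyY E Pr X 1 N M • nestedE E N := by
  rw [embeddingDer_two, bracket_En_E, bracket_En_E, sum_fin_one, ← Finset.sum_neg_distrib,
    ← Finset.sum_sub_distrib]
  refine Finset.sum_congr rfl fun Q _ => ?_
  rw [hierarchyY, ← neg_smul, ← sub_smul]
  rfl

theorem sum_fin_two {V : Type*} [AddCommMonoid V] (g : (Fin 2 → ι) → V) :
    ∑ M, g M = ∑ k : ι × ι, g ![k.1, k.2] := by
  rw [← (finTwoArrowEquiv ι).symm.sum_comp]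
  rfl

variable {R : Submodule ℝ (ι → En n)} {Pr : (k : ℕ) → Matrix (Fin k → ι) (Fin k → ι) ℝ}

theorem sum_embeddingDer_two (h2 : hierarchyRep E R Pr 2 ≤ levelRep E 2) {X : ι → En n}
    (hX : X ∈ R) {c : (Fin 2 → ι) → ℝ} (hc : ∑ M, c M • nestedE E M = 0) :
    ∑ M, c M • embeddingDer E (fun i => (X i : U n)) 2 M = 0 := by
  simp only [embeddingDer_two_eq_sum Pr, Finset.smul_sum, smul_smul]
  rw [Finset.sum_comm]
  refine Finset.sum_eq_zero fun N _ => ?_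
  rw [← Finset.sum_smul, sum_mul_eq_zero_of_mem_levelRep hc
    (h2 (Submodule.subset_span ⟨X, hX, N, rfl⟩)), zero_smul]

theorem isQuadRelation_embedding (h2 : hierarchyRep E R Pr 2 ≤ levelRep E 2) {X : ι → En n}
    (hX : X ∈ R) {c : ι × ι → ℝ} (hc : IsQuadRelation E c) :
    ∑ k, c k • (⁅(X k.1 : U n), (E k.2 : U n)⁆ + ⁅(X k.2 : U n), (E k.1 : U n)⁆) = 0 := by
  have := sum_embeddingDer_two h2 hX (c := fun M => c (M 0, M 1)) (by
    rw [sum_fin_two]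
    exact hc)
  rw [sum_fin_two] at this
  rw [← neg_eq_zero, ← this, ← Finset.sum_neg_distrib]
  refine Finset.sum_congr rfl fun k _ => ?_
  rw [embeddingDer_two, ← smul_neg, neg_add']
  rfl

/-- For k = 1 this is the hypothesis on r_2. For k ≥ 2 the sum commutes with everything and lies in
level -k with k ≤ K, where the form excludes nonzero such elements. -/
theorem sum_embeddingDer_eq_zero [DecidableEq ι] {B : U n →ₗ[ℝ] U n →ₗ[ℝ] ℝ}
    {F : Module.Basis ι ℝ (level n 1)} {P : (k : ℕ) → Matrix (Fin k → ι) (Fin k → ι) ℝ}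
    {a : ℕ → ℝ} {K : ℕ} (h : IsProjectorForm B E F P a K)
    (h2 : hierarchyRep E R Pr 2 ≤ levelRep E 2) {X : ι → En n} (hX : X ∈ R) {k : ℕ} (h1 : 1 ≤ k)
    (hk : k ≤ K) {c : (Fin (k + 1) → ι) → ℝ} (hc : ∑ M, c M • nestedE E M = 0) :
    ∑ M, c M • embeddingDer E (fun i => (X i : U n)) (k + 1) M = 0 := by
  have hX0 : ∀ M, (X M : U n) ∈ level n 0 := fun M => coe_En_mem _
  obtain rfl | h2' := h1.eq_or_lt
  · exact sum_embeddingDer_two h2 hX hc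
  · refine h.eq_zero_of_forall_bracket h2' hk
      (sum_mem fun M _ => Submodule.smul_mem _ _ (embeddingDer_mem hX0 k M)) fun x => ?_
    exact bracket_sum_embeddingDer hX0 (fun c hc => isQuadRelation_embedding h2 hX hc) hc x

/-- The projectors of the hierarchy, with the identity at level `1`. -/
noncomputable def extProjector [DecidableEq ι]
    (Pr : (k : ℕ) → Matrix (Fin k → ι) (Fin k → ι) ℝ) (k : ℕ) :
    Matrix (Fin k → ι) (Fin k → ι) ℝ := if k = 1 then 1 else Pr k

theorem extProjector_of_two_le {κ : Type*} [DecidableEq κ]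
    {Pr : (k : ℕ) → Matrix (Fin k → κ) (Fin k → κ) ℝ} {k : ℕ} (hk : 2 ≤ k) :
    extProjector Pr k = Pr k := if_neg (by omega)

theorem hierarchyY_succ (X : ι → En n) {k : ℕ} (hk : 1 ≤ k)
    (N : Fin (k + 1) → ι) (M : Fin (k + 2) → ι) :
    hierarchyY E Pr X (k + 1) N M =
      -∑ Q, Pr (k + 1) (Fin.cons (M 0) Q) N * hierarchyY E Pr X k Q (Fin.tail M) -
        ∑ Q, Pr (k + 1) Q N * derivation (repMatrix E (X (M 0))) (Fin.tail M) Q := by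
  obtain ⟨k, rfl⟩ := Nat.exists_eq_add_of_le' hk
  rw [hierarchyY, projUpper, projUpper]
  congr 2
  classical
  exact sum_smul_ite_head (M 0) (fun Q => Pr (k + 1 + 1) Q N)
    fun Q => hierarchyY E Pr X (k + 1) Q (Fin.tail M)

/-- The lower indices of the hierarchy beyond the first one are projected. -/
theorem sum_extProjector_mul [DecidableEq ι] (hPr : IsHierarchyProjector E R Pr) {k : ℕ}
    (hk : 1 ≤ k) (m : ι) (S : Fin k → ι) (N : Fin (k + 1) → ι) :
    ∑ Q, extProjector Pr k S Q * Pr (k + 1) (Fin.cons m Q) N = Pr (k + 1) (Fin.cons m S) N := by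
  obtain rfl | h2 := hk.eq_or_lt
  · simp [extProjector, Matrix.one_apply]
  obtain ⟨k, rfl⟩ := Nat.exists_eq_add_of_le' h2
  rw [extProjector_of_two_le h2]
  -- The claim says that the next projector kills m ⊗ e, where e = δ_S - Pr_S spans the failure of
  -- Pr to be the identity in row S. By `hPr.lower` it is enough that m ⊗ e annihilates every
  -- intertwiner, which is read off from the recursion.
  let e : (Fin (k + 2) → ι) → ℝ := fun Q => (if Q = S then 1 else 0) - Pr (k + 2) S Q
  have he : Matrix.vecMul e (Pr (k + 2)) = 0 := by
    rw [show e = (Pi.single S 1 : (Fin (k + 2) → ι) → ℝ) - Pr (k + 2) S by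
      ext; simp [e, Pi.single_apply], Matrix.sub_vecMul, Matrix.single_one_vecMul, sub_eq_zero]
    exact (congrFun (hPr.idempotent _ h2) S).symm
  let c : (Fin (k + 3) → ι) → ℝ := fun Q => if m = Q 0 then e (Fin.tail Q) else 0
  have hsum : ∀ g : (Fin (k + 3) → ι) → ℝ, ∑ Q, c Q * g Q = ∑ Q, e Q * g (Fin.cons m Q) := by
    intro g
    simp only [mul_comm _ (g _)]
    exact sum_smul_ite_head m g e
  have hc : Matrix.vecMul c (Pr (k + 3)) = 0 := by
    refine (hPr.lower (k + 3) (by omega) c).2 fun T hT => ?_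
    induction hT using Submodule.span_induction with
    | zero => simp
    | add S T _ _ hS hT => simp [mul_add, Finset.sum_add_distrib, hS, hT]
    | smul r T _ hT =>
      have : ∑ M, c M * (r • T) M = r * ∑ M, c M * T M := by
        rw [Finset.mul_sum]
        exact Finset.sum_congr rfl fun M _ => by rw [Pi.smul_apply, smul_eq_mul]; ring
      rw [this, hT, mul_zero]
    | mem T hT =>
      obtain ⟨X, hX, N, rfl⟩ := hT
      rw [hsum]
      simp only [hierarchyY_succ X (Nat.le_add_left 1 k), Fin.cons_zero, Fin.tail_cons]
      have h1 : ∑ Q, e Q * ∑ Q', Pr (k + 2) (Fin.cons m Q') N * hierarchyY E Pr X (k + 1) Q' Q =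
          0 := by
        simp only [Finset.mul_sum]
        rw [Finset.sum_comm]
        refine Finset.sum_eq_zero fun Q' _ => ?_
        have := (hPr.lower (k + 2) h2 e).1 he _ (Submodule.subset_span ⟨X, hX, Q', rfl⟩)
        rw [← mul_zero (Pr (k + 2) (Fin.cons m Q') N), ← this, Finset.mul_sum]
        exact Finset.sum_congr rfl fun Q _ => by ring
      have h3 : ∑ Q, e Q * ∑ Q', Pr (k + 2) Q' N * derivation (repMatrix E (X m)) Q Q' = 0 := by
        -- Equivariance moves the projector in front of the action of X_m, where it meets e.
        have h4 : Matrix.vecMul e (Matrix.of (derivation (repMatrix E (X m))) * Pr (k + 2)) = 0 := by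
          rw [← hPr.equivariant (k + 2) h2, ← Matrix.vecMul_vecMul, he, Matrix.zero_vecMul]
        have h5 := congrFun h4 N
        rw [Pi.zero_apply] at h5
        rw [← h5]
        simp only [Matrix.vecMul, dotProduct, Matrix.mul_apply, Matrix.of_apply, mul_comm]
      simp only [mul_sub, mul_neg, Finset.sum_sub_distrib, Finset.sum_neg_distrib, h1, h3]
      simp
  have h6 := congrFun hc N
  simp only [Matrix.vecMul, dotProduct, Pi.zero_apply] at h6
  rw [hsum] at h6
  simp only [e, sub_mul, Finset.sum_sub_distrib, ite_mul, one_mul, zero_mul, Finset.sum_ite_eq',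
    Finset.mem_univ, if_true] at h6
  exact (sub_eq_zero.1 h6).symm

/-- The projector at level `k` annihilates the coefficient tensors of vanishing elements. -/
def ProjectorFactors [DecidableEq ι] (E : Module.Basis ι ℝ (level n (-1)))
    (Pr : (k : ℕ) → Matrix (Fin k → ι) (Fin k → ι) ℝ) (k : ℕ) : Prop :=
  ∀ c : (Fin k → ι) → ℝ, ∑ M, c M • nestedE E M = 0 → Matrix.vecMul c (extProjector Pr k) = 0

theorem projectorFactors_one [DecidableEq ι] : ProjectorFactors E Pr 1 := by
  intro c hc
  rw [eq_zero_of_sum_nestedE_one hc, Matrix.zero_vecMul]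

/-- The intertwiner is the projection of the derivation given by the embedding tensor. -/
def IntertwinerFormula [DecidableEq ι] (E : Module.Basis ι ℝ (level n (-1)))
    (R : Submodule ℝ (ι → En n)) (Pr : (k : ℕ) → Matrix (Fin k → ι) (Fin k → ι) ℝ) (k : ℕ) :
    Prop :=
  ∀ X ∈ R, ∀ (M : Fin (k + 1) → ι) (d : (Fin k → ι) → ℝ),
    embeddingDer E (fun i => (X i : U n)) (k + 1) M = ∑ Q, d Q • nestedE E Q →
      ∀ N, hierarchyY E Pr X k N M = ∑ Q, d Q * extProjector Pr k Q N

theorem intertwinerFormula_one [DecidableEq ι] : IntertwinerFormula E R Pr 1 := by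
  intro X _ M d hd N
  rw [embeddingDer_two_eq_sum Pr, ← sub_eq_zero, ← Finset.sum_sub_distrib] at hd
  simp only [← sub_smul] at hd
  have h := congrFun (eq_zero_of_sum_nestedE_one hd) N
  simpa [extProjector, Matrix.one_apply, sub_eq_zero] using h

/-- Projecting the Leibniz rule D⟦E_{M₁}, y⟧ = -[X_{M₁}, y] - ⟦E_{M₁}, D y⟧ gives the recursion for
Y. The expansion coefficients are not unique, but by `hp` two choices have the same projection. -/
theorem IntertwinerFormula.succ [DecidableEq ι] (hPr : IsHierarchyProjector E R Pr) {k : ℕ}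
    (hk : 1 ≤ k) (hf : IntertwinerFormula E R Pr k) (hp : ProjectorFactors E Pr (k + 1)) :
    IntertwinerFormula E R Pr (k + 1) := by
  intro X hX M d' hd' N
  have hX0 : ∀ M, (X M : U n) ∈ level n 0 := fun M => coe_En_mem _
  obtain ⟨d, hd⟩ : ∃ d : (Fin k → ι) → ℝ, embeddingDer E (fun i => (X i : U n)) (k + 1)
      (Fin.tail M) = ∑ Q, d Q • nestedE E Q := by
    obtain ⟨k, rfl⟩ := Nat.exists_eq_add_of_le' hk
    exact exists_nestedE_expansion E (embeddingDer_mem hX0 (k + 1) (Fin.tail M))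
  have hY := hf X hX (Fin.tail M) d hd
  have hhead : ⁅(E (M 0) : U n), embeddingDer E (fun i => (X i : U n)) (k + 1) (Fin.tail M)⁆ =
      ∑ Q, (if M 0 = Q 0 then d (Fin.tail Q) else 0) • nestedE E Q := by
    have e := sum_smul_ite_head (M 0) (fun _ : Fin (k + 1) → ι => (1 : ℝ))
      fun Q => d Q • ⁅(E (M 0) : U n), nestedE E Q⁆
    obtain ⟨k, rfl⟩ := Nat.exists_eq_add_of_le' hk
    simp only [one_smul] at e
    rw [hd, bracket_sum]
    simp only [bracket_smul]
    rw [← e]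
    refine Finset.sum_congr rfl fun Q _ => ?_
    split_ifs with hQ
    · rw [hQ]; rfl
    · rw [zero_smul]
  have hc : ∑ Q, (d' Q + derivation (repMatrix E (X (M 0))) (Fin.tail M) Q +
      if M 0 = Q 0 then d (Fin.tail Q) else 0) • nestedE E Q = 0 := by
    simp only [add_smul, Finset.sum_add_distrib]
    rw [← hd', ← hhead, ← bracket_En_nestedE, embeddingDer]
    abel
  have h1 := congrFun (hp _ hc) N
  rw [extProjector_of_two_le (by omega)] at h1 ⊢
  simp only [Matrix.vecMul, dotProduct, Pi.zero_apply, add_mul, Finset.sum_add_distrib] at h1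
  have h2 : ∑ Q, (if M 0 = Q 0 then d (Fin.tail Q) else 0) * Pr (k + 1) Q N =
      ∑ Q, Pr (k + 1) (Fin.cons (M 0) Q) N * d Q := by
    simp only [mul_comm _ (Pr (k + 1) _ N)]
    exact sum_smul_ite_head (M 0) (fun Q => Pr (k + 1) Q N) d
  -- Y at level k is d already projected on r_k, and the projector on r_{k+1} absorbs that
  -- projection.
  have h3 : ∑ Q, Pr (k + 1) (Fin.cons (M 0) Q) N * hierarchyY E Pr X k Q (Fin.tail M) =
      ∑ Q, Pr (k + 1) (Fin.cons (M 0) Q) N * d Q := by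
    simp only [hY, Finset.mul_sum]
    rw [Finset.sum_comm]
    refine Finset.sum_congr rfl fun S _ => ?_
    rw [← sum_extProjector_mul hPr hk (M 0) S N, Finset.sum_mul]
    exact Finset.sum_congr rfl fun Q _ => by ring
  have h4 : ∑ Q, Pr (k + 1) Q N * derivation (repMatrix E (X (M 0))) (Fin.tail M) Q =
      ∑ Q, derivation (repMatrix E (X (M 0))) (Fin.tail M) Q * Pr (k + 1) Q N := by
    simp only [mul_comm]
  rw [hierarchyY_succ X hk, h3, h4]
  rw [h2] at h1
  linarith

/-- Expanding each D(E_M) turns `hc` into a relation at level -k, which the projector kills by `hp`;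
by `hf` the result is the contraction with Y. -/
theorem sum_mul_hierarchyY_eq_zero [DecidableEq ι] {k : ℕ} (hk : 1 ≤ k)
    (hf : IntertwinerFormula E R Pr k) (hp : ProjectorFactors E Pr k) {X : ι → En n} (hX : X ∈ R)
    {c : (Fin (k + 1) → ι) → ℝ}
    (hc : ∑ M, c M • embeddingDer E (fun i => (X i : U n)) (k + 1) M = 0) (N : Fin k → ι) :
    ∑ M, c M * hierarchyY E Pr X k N M = 0 := by
  have hX0 : ∀ M, (X M : U n) ∈ level n 0 := fun M => coe_En_mem _
  have hd : ∀ M, ∃ d : (Fin k → ι) → ℝ, embeddingDer E (fun i => (X i : U n)) (k + 1) M =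
      ∑ Q, d Q • nestedE E Q := by
    obtain ⟨k, rfl⟩ := Nat.exists_eq_add_of_le' hk
    exact fun M => exists_nestedE_expansion E (embeddingDer_mem hX0 (k + 1) M)
  choose d hd using hd
  have h1 : ∑ Q, (∑ M, c M * d M Q) • nestedE E Q = 0 := by
    simp only [hd, Finset.smul_sum, smul_smul] at hc
    rw [Finset.sum_comm] at hc
    simpa only [Finset.sum_smul] using hc
  have h2 := congrFun (hp _ h1) N
  simp only [Matrix.vecMul, dotProduct, Pi.zero_apply, Finset.sum_mul] at h2
  rw [Finset.sum_comm] at h2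
  rw [← h2]
  refine Finset.sum_congr rfl fun M _ => ?_
  rw [hf X hX M (d M) (hd M) N, Finset.mul_sum]
  exact Finset.sum_congr rfl fun Q _ => by ring

theorem hierarchyRep_succ_le_levelRep {k : ℕ} (hk : 1 ≤ k)
    (hY : ∀ X ∈ R, ∀ c : (Fin (k + 1) → ι) → ℝ, ∑ M, c M • nestedE E M = 0 →
      ∀ N, ∑ M, c M * hierarchyY E Pr X k N M = 0) :
    hierarchyRep E R Pr (k + 1) ≤ levelRep E (k + 1) := by
  obtain ⟨k, rfl⟩ := Nat.exists_eq_add_of_le' hk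
  refine Submodule.span_le.2 ?_
  rintro _ ⟨X, hX, N, rfl⟩
  exact mem_levelRep_of_forall fun c hc => hY X hX c hc N

theorem hierarchyRep_le_levelRep [DecidableEq ι] {B : U n →ₗ[ℝ] U n →ₗ[ℝ] ℝ}
    {F : Module.Basis ι ℝ (level n 1)} {P : (k : ℕ) → Matrix (Fin k → ι) (Fin k → ι) ℝ}
    {a : ℕ → ℝ} {K : ℕ} (h : IsProjectorForm B E F P a K) (hPr : IsHierarchyProjector E R Pr)
    (h2 : hierarchyRep E R Pr 2 ≤ levelRep E 2) {k : ℕ} (h1 : 1 ≤ k) (hk : k ≤ K + 1) :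
    hierarchyRep E R Pr k ≤ levelRep E k := by
  have step : ∀ k, 1 ≤ k → k ≤ K → IntertwinerFormula E R Pr k → ProjectorFactors E Pr k →
      hierarchyRep E R Pr (k + 1) ≤ levelRep E (k + 1) := fun k h1 hk hf hp =>
    hierarchyRep_succ_le_levelRep h1 fun X hX c hc N =>
      sum_mul_hierarchyY_eq_zero h1 hf hp hX (sum_embeddingDer_eq_zero h h2 hX h1 hk hc) N
  -- The two properties advance together: at level k they give the inclusion at k + 1, which makes
  -- the projector at k + 1 kill the relations, and this in turn gives the intertwiner formula
  -- there.
  have main : ∀ k, 1 ≤ k → k ≤ K → IntertwinerFormula E R Pr k ∧ ProjectorFactors E Pr k := by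
    intro k h1
    induction k, h1 using Nat.le_induction with
    | base => exact fun _ => ⟨intertwinerFormula_one, projectorFactors_one⟩
    | succ k h1 ih =>
      intro hk
      obtain ⟨hf, hp⟩ := ih (by omega)
      have hle := step k h1 (by omega) hf hp
      have hp' : ProjectorFactors E Pr (k + 1) := by
        intro c hc
        rw [extProjector_of_two_le (by omega)]
        exact (hPr.lower (k + 1) (by omega) c).2 fun T hT =>
          sum_mul_eq_zero_of_mem_levelRep hc (hle hT)
      exact ⟨hf.succ hPr h1 hp', hp'⟩
  obtain rfl | h1' := h1.eq_or_lt
  · refine fun T _ => mem_levelRep_of_forall fun c hc => ?_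
    rw [eq_zero_of_sum_nestedE_one hc]
    simp
  · obtain ⟨k, rfl⟩ := Nat.exists_eq_add_of_le' h1
    obtain ⟨hf, hp⟩ := main k (by omega) (by omega)
    exact step k (by omega) (by omega) hf hp

end Hierarchy

end Borcherds

/-- Here `q` is p - 1: the form is controlled up to level p = `q + 1`, and the inclusion holds up to
p + 1 = `q + 2`. -/
theorem mainTheorem1 (n : ℕ) (hn4 : 4 ≤ n) (hn8 : n ≤ 8)
    {ι : Type*} [Fintype ι] [DecidableEq ι]
    (E : Module.Basis ι ℝ (level n (-1))) (F : Module.Basis ι ℝ (level n 1))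
    (hEF : ∀ M N : ι, form n (E M : U n) (F N : U n) = if M = N then 1 else 0)
    (q : ℕ) (hq : 1 ≤ q)
    (P : (k : ℕ) → Matrix (Fin k → ι) (Fin k → ι) ℝ)
    (hP : ∀ k, 2 ≤ k → k ≤ q + 1 → IsLevelProjector E F k (P k))
    (a : ℕ → ℝ) (ha1 : a 1 = 1) (ha : ∀ k, 2 ≤ k → k ≤ q + 1 → a k ≠ 0)
    (hform : ∀ k, 2 ≤ k → k ≤ q + 1 → ∀ M N : Fin k → ι,
      form n (nestedE E M) (nestedF F N) = a k * P k M N) :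
    (∀ (m : ι) (N Q : Fin (q + 1) → ι),
      elementX E F a m N Q =
        projUpper (P (q + 1))
          (derivation (fun r s => elementX E F a m (fun _ : Fin 1 => r) (fun _ => s)) N) Q) ∧
    (∀ (N : Fin (q + 1) → ι) (M : Fin (q + 2) → ι),
      elementY E F a N M =
        - projUpper (P (q + 1))
            (fun Q => if M 0 = Q 0 then elementY E F a (Fin.tail Q) (Fin.tail M) else 0) N
          - elementX E F a (M 0) (Fin.tail M) N) ∧
    (∀ m r s : ι,
      elementY E F a (fun _ : Fin 1 => m) ![r, s] =
        - elementX E F a r (fun _ : Fin 1 => s) (fun _ => m)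
          - elementX E F a s (fun _ : Fin 1 => r) (fun _ => m)) ∧
    (∀ (R : Submodule ℝ (ι → En n)) (Pr : (k : ℕ) → Matrix (Fin k → ι) (Fin k → ι) ℝ),
      IsRepConstraint E R → IsHierarchyProjector E R Pr →
      hierarchyRep E R Pr 2 = levelRep E 2 →
      ∀ k, 1 ≤ k → k ≤ q + 2 → hierarchyRep E R Pr k ≤ levelRep E k) := by
  -- If ι is empty everything is trivial; otherwise the duality `hEF` excludes the default value 0
  -- of `form`, so the form is invariant.
  rcases isEmpty_or_nonempty ι with hι | ⟨⟨i⟩⟩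
  · refine ⟨fun m => isEmptyElim m, fun N => isEmptyElim (N 0), fun m => isEmptyElim m,
      fun R Pr _ _ _ k hk _ T _ => ?_⟩
    have : T = 0 := funext fun M => isEmptyElim (M ⟨0, hk⟩)
    rw [this]
    exact zero_mem _
  · have hB : IsInvariantForm n (form n) := by
      by_cases hex : ∃ B, IsInvariantForm n B
      · rw [form, dif_pos hex]
        exact hex.choose_spec
      · have := hEF i i
        rw [form, dif_neg hex] at this
        simp at this
    have h : IsProjectorForm (form n) E F P a (q + 1) := ⟨hB, hEF, hP, ha1, ha, hform⟩
    exact ⟨fun m N Q => h.elementX_eq (by omega) le_rfl m N Q,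
      fun N M => h.elementY_eq hq le_rfl N M, fun m r s => h.elementY_one_eq m r s,
      fun R Pr _ hPr h2 k h1 hk => hierarchyRep_le_levelRep h hPr h2.le h1 hk⟩
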